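/- Let $S\subset\mathbb R^d$ be compact, let $C_+(S)$ be the space of nonnegative continuous functions on $S$ with the uniform metric, and let $X=(X_t)_{t\in\mathbb Z}$ be a stationary $C_+(S)$-valued time series that is regularly varying with index $\alpha>0$: for every nonempty finite $T\subset\mathbb Z$ there are a nondecreasing sequence $a_n\to\infty$ and a non-zero measure $\mu_T$ on $C_+(S)^T\setminus\{0\}$, finite on measurable sets bounded away from $0$ and homogeneous of order $-\alpha$, such that $n\,P((a_n^{-1}X_t)_{t\in T}\in A)\to\mu_T(A)$ for every measurable $A$ bounded away from $0$ with $\mu_T(\partial A)=0$. Let $\Theta=(\Theta_t)_{t\in\mathbb Z}$ be its spectral tail process, that is, $\|\Theta_0\|_\infty=1$ a.s. and, for every finite $T\subset\mathbb Z$, the conditional law of $(X_t/\|X_0\|_\infty)_{t\in T}$ given $\|X_0\|_\infty>x$ converges weakly to the law of $(\Theta_t)_{t\in T}$ as $x\to\infty$. Let $r:C_+(S)\to[0,\infty)$ be continuous with $r(cf)=c\,r(f)$ for all $c\ge0$ and $f\in C_+(S)$, and assume $E[r(\Theta_0)^\alpha]>0$. Let $\Theta^r=(\Theta^r_t)_{t\in\mathbb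 Z}$ be a process whose law is that of $(\Theta_t/r(\Theta_0))_{t\in\mathbb Z}$ under the probability measure with density $r(\Theta_0)^\alpha/E[r(\Theta_0)^\alpha]$, and assume $E[(1-r(\Theta^r_{-1})^\alpha)_+]>0$. For $\ell\ge1$ define $$P(C^r_u=\ell)=\frac{P(r(X_{-1})\le u,\ r(X_0)>u,\dots,r(X_{\ell-1})>u,\ r(X_\ell)\le u)}{P(r(X_{-1})\le u,\ r(X_0)>u)} .$$ Then the denominator is positive for all large $u$, and for every $\ell\ge1$ $$\lim_{u\to\infty}P(C^r_u=\ell)=p_\ell:=\frac{E\big[\big(\min\{1,r(\Theta^r_1)^\alpha,\dots,r(\Theta^r_{\ell-1})^\alpha\}-\max\{r(\Theta^r_{-1})^\alpha,r(\Theta^r_\ell)^\alpha\}\big)_+\big]}{E\big[\big(1-r(\Theta^r_{-1})^\alpha\big)_+\big]} .$$ Moreover, if $V$ is independent of $\Theta^r$ with $P(V>y)=y^{-\alpha}$ for $y\ge1$, then $$p_\ell=\frac{P(V r(\Theta^r_{-1})\le1,\ V r(\Theta^r_0)>1,\dots,V r(\Theta^r_{\ell-1})>1,\ V r(\Theta^r_\ell)\le1)}{P(V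 r(\Theta^r_{-1})\le1,\ V r(\Theta^r_0)>1)},$$ and $\sum_{\ell\ge1}p_\ell=1$, so that $(p_\ell)$ is a probability distribution. Further, let $w^*\in\mathbb R\cup\{\infty\}$ and let $\phi:(-\infty,w^*)\to[0,\infty)$ be nondecreasing and bijective over $(0,\infty)$, i.e. each $u>0$ has exactly one preimage $\phi^{-1}(u)$. Let $W=(W_t)_{t\in\mathbb Z}$ be a stationary $C(S)$-valued time series such that almost surely $W_t(s)<w^*$ and $X_t(s)=\phi(W_t(s))$ for all $s,t$, and let $r$ be also given on continuous functions $f:S\to(-\infty,w^*)$, with values in $(-\infty,w^*)$ and $\phi(r(f))=r(\phi\circ f)$. Then $\phi^{-1}(u)\to w^*$ as $u\to\infty$, and for every $\ell\ge1$ $$\frac{P(r(W_{-1})\le \phi^{-1}(u),\ r(W_0)>\phi^{-1}(u),\dots,r(W_{\ell-1})>\phi^{-1}(u),\ r(W_\ell)\le \phi^{-1}(u))}{P(r(W_{-1})\le \phi^{-1}(u),\ r(W_0)>\phi^{-1}(u))}$$ equals $P(C^r_u=\ell)$ for every $u>0$, and hence converges to $p_\ell$ as $u\to\infty$. -/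

import Mathlib

open MeasureTheory ProbabilityTheory Filter Topology
open scoped NNReal ENNReal Pointwise

noncomputable section

namespace ClusterExtremes

/-- The space of nonnegative continuous functions on a compact space, with the uniform metric. -/
abbrev CPlus (K : Type*) [TopologicalSpace K] : Type _ := C(K, ℝ≥0)

/-- The supremum norm of a nonnegative continuous function, i.e. its uniform distance to `0`. -/
def supNorm {K : Type*} [TopologicalSpace K] [CompactSpace K] (f : CPlus K) : ℝ := dist f 0

/-- A (strictly) stationary time series of random elements of `E`. -/
structure IsStationary {Ω E : Type*} [MeasurableSpace Ω] [MeasurableSpace E]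
    (P : Measure Ω) (X : ℤ → Ω → E) : Prop where
  measurable : ∀ t, Measurable (X t)
  map_shift : ∀ h : ℤ, P.map (fun ω t => X (t + h) ω) = P.map (fun ω t => X t ω)

section RegularVariation

variable {K : Type*} [TopologicalSpace K] [CompactSpace K] [MeasurableSpace (CPlus K)]

/-- A set of vectors of functions is bounded away from the origin. -/
def BoundedAway {T : Finset ℤ} (A : Set (T → CPlus K)) : Prop :=
  ∃ ε : ℝ, 0 < ε ∧ ∀ x ∈ A, ε ≤ dist x 0

/-- `μ` is the exponent measure of `(X_t)_{t ∈ T}` for the normalizing sequence `a`, homogeneous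
of order `-α`. A measure on the space without the origin is a measure on the whole space that
does not charge the origin. -/
structure IsExponentMeasure {Ω : Type*} [MeasurableSpace Ω] (P : Measure Ω)
    (X : ℤ → Ω → CPlus K) (α : ℝ) (T : Finset ℤ) (a : ℕ → ℝ≥0)
    (μ : Measure (T → CPlus K)) : Prop where
  monotone : Monotone a
  tendsto_atTop : Tendsto a atTop atTop
  ne_zero : μ ≠ 0
  origin : μ {0} = 0
  finite : ∀ A, MeasurableSet A → BoundedAway A → μ A < ∞
  tendsto : ∀ A, MeasurableSet A → BoundedAway A → μ (frontier A) = 0 →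
    Tendsto (fun n : ℕ => (n : ℝ≥0∞) * P {ω | (fun t : T => (a n)⁻¹ • X t ω) ∈ A}) atTop
      (𝓝 (μ A))
  homogeneous : ∀ c : ℝ≥0, 0 < c → ∀ A, MeasurableSet A →
    μ (c • A) = ENNReal.ofReal ((c : ℝ) ^ (-α)) * μ A

/-- A stationary time series with values in `C₊(K)` is regularly varying with index `α`. -/
structure IsRegularlyVarying {Ω : Type*} [MeasurableSpace Ω] (P : Measure Ω)
    (X : ℤ → Ω → CPlus K) (α : ℝ) : Prop where
  stationary : IsStationary P X
  exists_exponentMeasure : ∀ T : Finset ℤ, T.Nonempty → ∃ a μ, IsExponentMeasure P X α T a μ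

/-- `Θ` is a spectral tail process of `X`: `‖Θ₀‖ = 1` almost surely, and for each finite `T` the
conditional law of `(‖X₀‖⁻¹ X_t)_{t ∈ T}` given `‖X₀‖ > x` converges weakly to the law of
`(Θ_t)_{t ∈ T}` as `x → ∞`. -/
structure IsSpectralTailProcess {Ω Ω' : Type*} [MeasurableSpace Ω] [MeasurableSpace Ω']
    (P : Measure Ω) (X : ℤ → Ω → CPlus K) (P' : Measure Ω') (Θ : ℤ → Ω' → CPlus K) : Prop where
  measurable : ∀ t, Measurable (Θ t)
  norm_zero : ∀ᵐ ω ∂P', supNorm (Θ 0 ω) = 1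
  tendsto : ∀ (T : Finset ℤ) (g : BoundedContinuousFunction (T → CPlus K) ℝ),
    Tendsto
      (fun x : ℝ => ∫ ω, g (fun t : T => (supNorm (X 0 ω)).toNNReal⁻¹ • X t ω)
        ∂(P[|{ω | x < supNorm (X 0 ω)}])) atTop
      (𝓝 (∫ ω, g (fun t : T => Θ t ω) ∂P'))

/-- A risk functional: continuous and positively `1`-homogeneous. -/
structure IsRiskFunctional (r : CPlus K → ℝ≥0) : Prop where
  continuous : Continuous r
  homogeneous : ∀ (c : ℝ≥0) (f : CPlus K), r (c • f) = c * r f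

/-- The law of the process `Θ^r`, where `Q` is the law of `Θ`: the law of `(Θ_t / r(Θ₀))_t` under
the probability measure with density `r(Θ₀)^α / E[r(Θ₀)^α]`. By homogeneity of `r`, the sequence
`r(Θ^r_t)` is `r(Θ_t) / r(Θ₀)` under that measure. -/
def riskSpectralLaw (r : CPlus K → ℝ≥0) (α : ℝ) (Q : Measure (ℤ → CPlus K)) :
    Measure (ℤ → CPlus K) :=
  ((∫⁻ θ, ((r (θ 0) ^ α : ℝ≥0) : ℝ≥0∞) ∂Q)⁻¹ •
    Q.withDensity (fun θ => ((r (θ 0) ^ α : ℝ≥0) : ℝ≥0∞))).map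
      (fun θ t => (r (θ 0))⁻¹ • θ t)

/-- `E[min{1, r(Θ^r_1)^α, …, r(Θ^r_{ℓ-1})^α} - max{r(Θ^r_{-1})^α, r(Θ^r_ℓ)^α}]₊`, where `Q` is the
law of `Θ^r`. -/
def limitNumerator (r : CPlus K → ℝ≥0) (α : ℝ) (Q : Measure (ℤ → CPlus K)) (ℓ : ℕ) : ℝ :=
  ∫ θ, max ((Finset.Ico 1 ℓ).fold min 1 (fun i : ℕ => (r (θ i) : ℝ) ^ α)
    - max ((r (θ (-1)) : ℝ) ^ α) ((r (θ ℓ) : ℝ) ^ α)) 0 ∂Q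

/-- `E[1 - r(Θ^r_{-1})^α]₊`, where `Q` is the law of `Θ^r`. -/
def limitDenominator (r : CPlus K → ℝ≥0) (α : ℝ) (Q : Measure (ℤ → CPlus K)) : ℝ :=
  ∫ θ, max (1 - (r (θ (-1)) : ℝ) ^ α) 0 ∂Q

end RegularVariation

/-- A `u`-exceedance cluster of the real sequence `R` starts at time `t`. -/
def ClusterStarts (R : ℤ → ℝ) (u : ℝ) (t : ℤ) : Prop := R (t - 1) ≤ u ∧ u < R t

/-- The stretch `t, …, t + ℓ - 1` is a `u`-exceedance cluster (of size `ℓ`) of `R`. -/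
def IsCluster (R : ℤ → ℝ) (u : ℝ) (t : ℤ) (ℓ : ℕ) : Prop :=
  R (t - 1) ≤ u ∧ (∀ i : ℕ, i < ℓ → u < R (t + i)) ∧ R (t + ℓ) ≤ u

/-- The probability that a `u`-exceedance cluster of the random sequence `R` has size `ℓ`: the
probability that a cluster of size `ℓ` starts at time `0`, divided by the probability that a
cluster starts at time `0`. -/
def clusterSizeProb {Ω : Type*} [MeasurableSpace Ω] (P : Measure Ω) (R : ℤ → Ω → ℝ)
    (u : ℝ) (ℓ : ℕ) : ℝ :=
  P.real {ω | IsCluster (fun t => R t ω) u 0 ℓ} / P.real {ω | ClusterStarts (fun t => R t ω) u 0}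

/-- The half-line `(-∞, w*)`, with `w*` real or `∞`. -/
def below (wstar : EReal) : Set ℝ := {w | (w : EReal) < wstar}

/-- A nondecreasing marginal transformation `φ : (-∞, w*) → [0, ∞)`, bijective over `(0, ∞)`.
(No nondecreasing map is a bijection from `(-∞, w*)` onto `[0, ∞)` including the value `0`; both
increasing bijections onto `(0, ∞)` and maps such as the positive part are covered.) -/
structure IsMarginalTransform (φ : ℝ → ℝ) (wstar : EReal) : Prop where
  monotoneOn : MonotoneOn φ (below wstar)
  nonneg : ∀ w ∈ below wstar, 0 ≤ φ w
  bijOn : Set.BijOn φ (below wstar ∩ {w | 0 < φ w}) (Set.Ioi 0)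

/-- The inverse `φ⁻¹(u)`, for `u > 0`. -/
def transformInv (φ : ℝ → ℝ) (wstar : EReal) (u : ℝ) : ℝ :=
  Function.invFunOn φ (below wstar) u

/-- The functional `rho` on continuous functions with values in `(-∞, w*)` and the risk functional
`r` on nonnegative functions satisfy `φ(rho(f)) = r(φ ∘ f)`. In the applications `rho` and `r` are
given by one formula (a minimum, a maximum, a quantile). -/
def CommutesWith {K : Type*} [TopologicalSpace K] (r : CPlus K → ℝ≥0) (rho : C(K, ℝ) → ℝ)
    (φ : ℝ → ℝ) (wstar : EReal) : Prop :=
  ∀ f : C(K, ℝ), (∀ s, f s ∈ below wstar) →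
    rho f ∈ below wstar ∧
      ∀ g : CPlus K, (∀ s, (g s : ℝ) = φ (f s)) → φ (rho f) = (r g : ℝ)

end ClusterExtremes

end

noncomputable section

namespace ClusterExtremes

/-! ### Regular variation along a sequence -/

/-! Let `G` be the tail of `‖X₀‖` and `κ = E[r(Θ₀)^α]`. Everything rests on one asymptotic relation,
`tendsto_tail_functional`: if `h` is a continuous 1-homogeneous functional of finitely many
coordinates with `h(x) ≤ r(x₀)`, then `P(h(X) > u) / G(u) → E[h(Θ)^α]`. Indeed `h(X) = ‖X₀‖ ·
h(X/‖X₀‖)`, where the second factor is bounded and, given that `‖X₀‖` is large, has asymptotically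
the law of `h(Θ)` independently of the size of `‖X₀‖`; a Breiman-type argument (`tendsto_tail_mul`)
then applies, `G` being regularly varying (`tendsto_tail_ratio`).

A cluster of size `ℓ` starts at `0` iff `m(X) > u` and `M(X) ≤ u`, with `m` the minimum of the risks
in the stretch and `M` the maximum of its two neighbours. This is the tail event of `m` minus that
of `min m M`, so its probability over `G(u)` tends to `E[(m(Θ)^α - M(Θ)^α)₊]`. The change of measure
defining `Θ^r` turns this into `κ` times the numerator of `p_ℓ`. The start of a cluster is treated
alike, and in the quotient `κ` and `G(u)` cancel.

The Pareto formula is the exact counterpart, from `P(V x > 1) = x^α` for `0 ≤ x ≤ 1`. No mass is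
lost in the sum because, by stationarity, `n + 1` translates of the event of a cluster longer than
`n` are disjoint parts of an exceedance at time `0`. A monotone transform preserves the exceedance
events, hence the cluster probabilities. -/

/-- A nonincreasing function that is regularly varying along a sequence `a n → ∞` is regularly
varying. -/
lemma tendsto_tail_ratio {G : ℝ → ℝ} (hG : Antitone G) (hG0 : ∀ u, 0 ≤ G u) {a : ℕ → ℝ}
    (ha : Monotone a) (ha' : Tendsto a atTop atTop) {α c : ℝ} (hc : 0 < c)
    (h : ∀ y : ℝ, 0 < y → Tendsto (fun n : ℕ => (n : ℝ) * G (a n * y)) atTop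
      (𝓝 (c * y ^ (-α)))) :
    (∀ u, 0 < G u) ∧
      ∀ y : ℝ, 0 < y → Tendsto (fun u => G (u * y) / G u) atTop (𝓝 (y ^ (-α))) := by
  have h1 : Tendsto (fun n : ℕ => (n : ℝ) * G (a n)) atTop (𝓝 c) := by
    simpa using h 1 one_pos
  have hpos : ∀ u, 0 < G u := by
    intro u
    obtain ⟨n, hn, hn'⟩ := ((h1.eventually (lt_mem_nhds hc)).and
      (ha'.eventually (eventually_ge_atTop u))).exists
    have : 0 < G (a n) := by
      rcases (hG0 (a n)).lt_or_eq with h0 | h0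
      · exact h0
      · rw [← h0] at hn; simp at hn
    exact this.trans_le (hG hn')
  refine ⟨hpos, fun y hy => ?_⟩
  have hshift : Tendsto (fun n : ℕ => ((n : ℝ) + 1) * G (a (n + 1))) atTop (𝓝 c) := by
    simpa [Function.comp_def] using h1.comp (tendsto_add_atTop_nat 1)
  have hshift' : Tendsto (fun n : ℕ => ((n : ℝ) + 1) * G (a (n + 1) * y)) atTop
      (𝓝 (c * y ^ (-α))) := by
    simpa [Function.comp_def] using (h y hy).comp (tendsto_add_atTop_nat 1)
  have hq : Tendsto (fun n : ℕ => (n : ℝ) / (n + 1)) atTop (𝓝 1) :=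
    tendsto_natCast_div_add_atTop 1
  -- Shifting one index by one changes the limit only by the factor `n / (n + 1) → 1`.
  have hup : Tendsto (fun n : ℕ => G (a n * y) / G (a (n + 1))) atTop (𝓝 (y ^ (-α))) := by
    have := ((h y hy).div hshift hc.ne').mul (hq.inv₀ one_ne_zero)
    rw [inv_one, mul_one, mul_div_cancel_left₀ _ hc.ne'] at this
    refine this.congr' ?_
    filter_upwards [eventually_gt_atTop 0] with n hn
    have hn' : (0 : ℝ) < n := by exact_mod_cast hn
    have := hpos (a (n + 1))
    simp only [Pi.div_apply]
    field_simp
  have hlo : Tendsto (fun n : ℕ => G (a (n + 1) * y) / G (a n)) atTop (𝓝 (y ^ (-α))) := by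
    have := (hshift'.div h1 hc.ne').mul hq
    rw [mul_one, mul_div_cancel_left₀ _ hc.ne'] at this
    refine this.congr' ?_
    filter_upwards [eventually_gt_atTop 0] with n hn
    have hn' : (0 : ℝ) < n := by exact_mod_cast hn
    have := hpos (a n)
    simp only [Pi.div_apply]
    field_simp
  have hex : ∀ u, ∃ n, u < a n := fun u => (ha'.eventually (eventually_gt_atTop u)).exists
  classical
  -- The index with `a (ν u) ≤ u < a (ν u + 1)`; the truncated subtraction is harmless once `u ≥ a
  -- 0`.
  let ν : ℝ → ℕ := fun u => Nat.find (hex u) - 1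
  have hν : Tendsto ν atTop atTop := by
    refine tendsto_atTop.2 fun k => ?_
    filter_upwards [eventually_ge_atTop (a k)] with u hu
    have : k < Nat.find (hex u) := by
      rw [Nat.lt_find_iff]
      intro m hm
      exact not_lt.2 ((ha hm).trans hu)
    simp only [ν]; omega
  have hbr : ∀ᶠ u in atTop, a (ν u) ≤ u ∧ u < a (ν u + 1) := by
    filter_upwards [eventually_ge_atTop (a 0)] with u hu
    have h0 : 0 < Nat.find (hex u) := by
      rw [Nat.lt_find_iff]
      intro m hm
      exact not_lt.2 ((ha hm).trans hu)
    constructor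
    · have : ν u < Nat.find (hex u) := by simp only [ν]; omega
      exact not_lt.1 (Nat.find_min (hex u) this)
    · have : ν u + 1 = Nat.find (hex u) := by simp only [ν]; omega
      rw [this]
      exact Nat.find_spec (hex u)
  refine tendsto_of_tendsto_of_tendsto_of_le_of_le' (hlo.comp hν) (hup.comp hν) ?_ ?_
  · filter_upwards [hbr] with u hu
    exact div_le_div₀ (hG0 _) (hG (mul_le_mul_of_nonneg_right hu.2.le hy.le)) (hpos _) (hG hu.1)
  · filter_upwards [hbr] with u hu
    exact div_le_div₀ (hG0 _) (hG (mul_le_mul_of_nonneg_right hu.1 hy.le)) (hpos _) (hG hu.2.le)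

/-! ### A piecewise linear partition of unity -/

/-- The ramp function, equal to `0` on the left of `0` and to `1` on the right of `1`. -/
def ramp (x : ℝ) : ℝ := max 0 (min 1 x)

lemma continuous_ramp : Continuous ramp := by unfold ramp; fun_prop

lemma ramp_mono : Monotone ramp := fun x y h => by unfold ramp; gcongr

lemma ramp_nonneg (x : ℝ) : 0 ≤ ramp x := le_max_left _ _

lemma ramp_le_one (x : ℝ) : ramp x ≤ 1 := max_le zero_le_one (min_le_left _ _)

lemma ramp_of_nonpos {x : ℝ} (h : x ≤ 0) : ramp x = 0 :=
  max_eq_left ((min_le_right _ _).trans h)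

lemma ramp_of_one_le {x : ℝ} (h : 1 ≤ x) : ramp x = 1 := by
  simp [ramp, min_eq_left h]

/-- The tent of width `2δ` centred at `iδ`. -/
def tentFun (δ : ℝ) (i : ℕ) (x : ℝ) : ℝ := ramp (x / δ - i + 1) - ramp (x / δ - i)

lemma tentFun_nonneg (δ : ℝ) (i : ℕ) (x : ℝ) : 0 ≤ tentFun δ i x :=
  sub_nonneg.2 (ramp_mono (by linarith))

lemma tentFun_le_one (δ : ℝ) (i : ℕ) (x : ℝ) : tentFun δ i x ≤ 1 := by
  have h1 := ramp_le_one (x / δ - i + 1)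
  have h2 := ramp_nonneg (x / δ - i)
  unfold tentFun; linarith

lemma continuous_tentFun (δ : ℝ) (i : ℕ) : Continuous (tentFun δ i) := by
  have := continuous_ramp
  unfold tentFun; fun_prop

/-- The tent function as a bounded continuous function. -/
def tent (δ : ℝ) (i : ℕ) : BoundedContinuousFunction ℝ ℝ :=
  BoundedContinuousFunction.ofNormedAddCommGroup (tentFun δ i) (continuous_tentFun δ i) 1
    fun x => by
      rw [Real.norm_of_nonneg (tentFun_nonneg δ i x)]
      exact tentFun_le_one δ i x

@[simp] lemma tent_apply (δ : ℝ) (i : ℕ) (x : ℝ) : tent δ i x = tentFun δ i x := rfl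

lemma tentFun_ne_zero {δ : ℝ} (hδ : 0 < δ) {i : ℕ} {x : ℝ} (h : tentFun δ i x ≠ 0) :
    x < (i + 1) * δ ∧ (i - 1) * δ < x := by
  constructor
  · by_contra! hx
    have : (i : ℝ) + 1 ≤ x / δ := (le_div_iff₀ hδ).2 hx
    exact h (by rw [tentFun, ramp_of_one_le (by linarith), ramp_of_one_le (by linarith), sub_self])
  · by_contra! hx
    have : x / δ ≤ i - 1 := (div_le_iff₀ hδ).2 hx
    exact h (by rw [tentFun, ramp_of_nonpos (by linarith), ramp_of_nonpos (by linarith), sub_self])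

/-- The sum telescopes to `ramp (x / δ + 1) - ramp (x / δ - n) = 1 - 0`. -/
lemma sum_tentFun {δ : ℝ} (hδ : 0 < δ) {n : ℕ} {x : ℝ} (hx : 0 ≤ x) (hx' : x ≤ n * δ) :
    ∑ i ∈ Finset.range (n + 1), tentFun δ i x = 1 := by
  have h := Finset.sum_range_sub' (fun i : ℕ => ramp (x / δ - i + 1)) (n + 1)
  have h2 : ∀ i : ℕ, tentFun δ i x
      = ramp (x / δ - i + 1) - ramp (x / δ - (i + 1 : ℕ) + 1) := by
    intro i; unfold tentFun; push_cast; ring_nf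
  simp_rw [h2, h]
  have h3 : 0 ≤ x / δ := div_nonneg hx hδ.le
  have h4 : x / δ ≤ n := (div_le_iff₀ hδ).2 hx'
  rw [ramp_of_one_le (by simpa using h3), ramp_of_nonpos (by push_cast; linarith), sub_zero]

/-- The sum is a weighted average of the `w i`, and only indices with `|x - iδ| < δ` carry weight.
-/
lemma sum_mul_tentFun_le {δ : ℝ} (hδ : 0 < δ) {n : ℕ} {x : ℝ} (hx : 0 ≤ x) (hx' : x ≤ n * δ)
    {w : ℕ → ℝ} {B : ℝ} (hw : ∀ i : ℕ, x < (i + 1) * δ → (i - 1) * δ < x → w i ≤ B) :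
    ∑ i ∈ Finset.range (n + 1), w i * tentFun δ i x ≤ B := by
  calc _ ≤ ∑ i ∈ Finset.range (n + 1), B * tentFun δ i x := by
        refine Finset.sum_le_sum fun i _ => ?_
        by_cases h : tentFun δ i x = 0
        · simp [h]
        · obtain ⟨h1, h2⟩ := tentFun_ne_zero hδ h
          exact mul_le_mul_of_nonneg_right (hw i h1 h2) (tentFun_nonneg _ _ _)
    _ = B := by rw [← Finset.mul_sum, sum_tentFun hδ hx hx', mul_one]

lemma le_sum_mul_tentFun {δ : ℝ} (hδ : 0 < δ) {n : ℕ} {x : ℝ} (hx : 0 ≤ x) (hx' : x ≤ n * δ)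
    {w : ℕ → ℝ} {B : ℝ} (hw : ∀ i : ℕ, x < (i + 1) * δ → (i - 1) * δ < x → B ≤ w i) :
    B ≤ ∑ i ∈ Finset.range (n + 1), w i * tentFun δ i x := by
  calc B = ∑ i ∈ Finset.range (n + 1), B * tentFun δ i x := by
        rw [← Finset.mul_sum, sum_tentFun hδ hx hx', mul_one]
    _ ≤ _ := by
        refine Finset.sum_le_sum fun i _ => ?_
        by_cases h : tentFun δ i x = 0
        · simp [h]
        · obtain ⟨h1, h2⟩ := tentFun_ne_zero hδ h
          exact mul_le_mul_of_nonneg_right (hw i h1 h2) (tentFun_nonneg _ _ _)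

/-! ### The tail of a product with an asymptotically independent factor -/

section Product

variable {Ω Ω' : Type*} [MeasurableSpace Ω] [MeasurableSpace Ω'] {P : Measure Ω}
  {P' : Measure Ω'} [IsProbabilityMeasure P] [IsProbabilityMeasure P']

lemma integrable_of_ae_mem_Icc {f : Ω → ℝ} (hf : Measurable f) {C : ℝ}
    (h : ∀ᵐ ω ∂P, 0 ≤ f ω ∧ f ω ≤ C) : Integrable f P :=
  Integrable.of_bound hf.aestronglyMeasurable C <| by
    filter_upwards [h] with ω hω
    rw [Real.norm_of_nonneg hω.1]; exact hω.2

/-- If, given a large value of `N`, the variable `H` is asymptotically independent of `N` with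
limit law that of `H'`, and `N` has a regularly varying tail `G`, then the tail of `N * H` is
asymptotic to `E[H' ^ α]` times `G`. -/
lemma tendsto_tail_mul {N H : Ω → ℝ} {H' : Ω' → ℝ} {G : ℝ → ℝ} {α C : ℝ} (hα : 0 < α)
    (hC : 0 < C) (hN : Measurable N) (hN0 : ∀ ω, 0 ≤ N ω) (hH : Measurable H)
    (hH' : Measurable H') (hHC : ∀ ω, 0 ≤ H ω ∧ H ω ≤ C)
    (hHC' : ∀ᵐ ω ∂P', 0 ≤ H' ω ∧ H' ω ≤ C) (hG : ∀ u, 0 < G u)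
    (h : ∀ y : ℝ, 0 ≤ y → ∀ g : BoundedContinuousFunction ℝ ℝ,
      Tendsto (fun u => (∫ ω in {ω | u < N ω * y}, g (H ω) ∂P) / G u) atTop
        (𝓝 (y ^ α * ∫ ω, g (H' ω) ∂P'))) :
    Tendsto (fun u => P.real {ω | u < N ω * H ω} / G u) atTop (𝓝 (∫ ω, H' ω ^ α ∂P')) := by
  -- Discretization: the tents localize `H` near `iδ`, and there the random factor `H` in the event
  -- is replaced by a constant `y i`, so the hypothesis applies term by term. The choice of `y i`
  -- makes the sum a lower or an upper bound.
  have key : ∀ (n : ℕ) (y : ℕ → ℝ), (∀ i, 0 ≤ y i) → ∀ δ : ℝ,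
      Tendsto (fun u => (∑ i ∈ Finset.range (n + 1),
        ∫ ω in {ω | u < N ω * y i}, tent δ i (H ω) ∂P) / G u) atTop
        (𝓝 (∫ ω, ∑ i ∈ Finset.range (n + 1), y i ^ α * tentFun δ i (H' ω) ∂P')) := by
    intro n y hy δ
    have hint : ∀ i, Integrable (fun ω => tentFun δ i (H' ω)) P' := fun i =>
      integrable_of_ae_mem_Icc ((continuous_tentFun δ i).measurable.comp hH')
        (Eventually.of_forall fun ω => ⟨tentFun_nonneg _ _ _, tentFun_le_one _ _ _⟩)
    rw [integral_finsetSum _ fun i _ => (hint i).const_mul _]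
    simp_rw [Finset.sum_div, integral_const_mul]
    exact tendsto_finsetSum _ fun i _ => h (y i) (hy i) (tent δ i)
  have hset : ∀ (u : ℝ) (f : Ω → ℝ), Measurable f → MeasurableSet {ω | u < N ω * f ω} :=
    fun u f hf => measurableSet_lt measurable_const (hN.mul hf)
  have hsum : ∀ (n : ℕ) (y : ℕ → ℝ) (δ u : ℝ), (∑ i ∈ Finset.range (n + 1),
        ∫ ω in {ω | u < N ω * y i}, tent δ i (H ω) ∂P)
      = ∫ ω, ∑ i ∈ Finset.range (n + 1),
          {ω | u < N ω * y i}.indicator 1 ω * tentFun δ i (H ω) ∂P := by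
    intro n y δ u
    have hm : ∀ i, MeasurableSet {ω | u < N ω * y i} := fun i => hset u _ measurable_const
    rw [integral_finsetSum]
    · refine Finset.sum_congr rfl fun i _ => ?_
      rw [← integral_indicator (hm i)]
      refine integral_congr_ae (Eventually.of_forall fun ω => ?_)
      by_cases hω : ω ∈ {ω | u < N ω * y i} <;> simp [hω, Set.indicator]
    · intro i _
      refine integrable_of_ae_mem_Icc (C := 1) ((measurable_one.indicator (hm i)).mul
        ((continuous_tentFun δ i).measurable.comp hH)) (Eventually.of_forall fun ω => ?_)
      have h1 := tentFun_nonneg δ i (H ω)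
      have h2 := tentFun_le_one δ i (H ω)
      by_cases hω : u < N ω * y i <;> simp [hω, Set.indicator, h1, h2]
  have hsint : ∀ (n : ℕ) (y : ℕ → ℝ) (δ u : ℝ), Integrable (fun ω =>
      ∑ i ∈ Finset.range (n + 1), {ω | u < N ω * y i}.indicator 1 ω * tentFun δ i (H ω)) P := by
    intro n y δ u
    refine integrable_finsetSum _ fun i _ => ?_
    have hm : MeasurableSet {ω | u < N ω * y i} := hset u _ measurable_const
    refine integrable_of_ae_mem_Icc (C := 1) ((measurable_one.indicator hm).mul
        ((continuous_tentFun δ i).measurable.comp hH)) (Eventually.of_forall fun ω => ?_)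
    have h1 := tentFun_nonneg δ i (H ω)
    have h2 := tentFun_le_one δ i (H ω)
    by_cases hω : u < N ω * y i <;> simp [hω, Set.indicator, h1, h2]
  have hreal : ∀ u, P.real {ω | u < N ω * H ω}
      = ∫ ω, {ω | u < N ω * H ω}.indicator 1 ω ∂P := fun u =>
    (integral_indicator_one (hset u H hH)).symm
  have hiint : ∀ u, Integrable ({ω | u < N ω * H ω}.indicator (1 : Ω → ℝ)) P := fun u =>
    (integrable_const (1 : ℝ)).indicator (hset u H hH)
  have hpow : ∀ f : ℝ → ℝ, Continuous f → ∀ D : ℝ,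
      (∀ x, 0 ≤ x → x ≤ C → 0 ≤ f x ∧ f x ≤ D) → Integrable (fun ω => f (H' ω) ^ α) P' := by
    intro f hf D hD
    refine integrable_of_ae_mem_Icc (C := D ^ α)
      ((hf.measurable.comp hH').pow_const α) ?_
    filter_upwards [hHC'] with ω hω
    obtain ⟨h1, h2⟩ := hD _ hω.1 hω.2
    exact ⟨Real.rpow_nonneg h1 _, Real.rpow_le_rpow h1 h2 hα.le⟩
  have htint : ∀ (n : ℕ) (y : ℕ → ℝ) (δ : ℝ), Integrable (fun ω =>
      ∑ i ∈ Finset.range (n + 1), y i ^ α * tentFun δ i (H' ω)) P' := by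
    intro n y δ
    refine integrable_finsetSum _ fun i _ => Integrable.const_mul ?_ _
    exact integrable_of_ae_mem_Icc ((continuous_tentFun δ i).measurable.comp hH')
        (Eventually.of_forall fun ω => ⟨tentFun_nonneg _ _ _, tentFun_le_one _ _ _⟩)
  have hδ : ∀ n : ℕ, 0 < C / (n + 1 : ℕ) := fun n => by positivity
  have hδC : ∀ n : ℕ, C ≤ (n + 1 : ℕ) * (C / (n + 1 : ℕ)) := fun n => by
    rw [mul_div_cancel₀]; positivity
  have hδ0 : Tendsto (fun n : ℕ => C / (n + 1 : ℕ)) atTop (𝓝 0) :=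
    (tendsto_const_div_atTop_nhds_zero_nat C).comp (tendsto_add_atTop_nat 1)
  have hδ1 : ∀ n : ℕ, C / (n + 1 : ℕ) ≤ C := fun n => by
    apply div_le_self hC.le; push_cast; linarith [n.cast_nonneg (α := ℝ)]
  -- Vanishing mesh: `f x δ` will be `x` shifted by at most `2δ`, whence the dominating bound `3 *
  -- C` for `δ ≤ C`.
  have happrox : ∀ f : ℝ → ℝ → ℝ, (∀ x, 0 ≤ x → Tendsto (f x) (𝓝 0) (𝓝 x)) →
      (∀ δ, Continuous (f · δ)) →
      (∀ x δ, 0 ≤ x → x ≤ C → 0 ≤ δ → δ ≤ C → 0 ≤ f x δ ∧ f x δ ≤ 3 * C) →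
      Tendsto (fun n : ℕ => ∫ ω, f (H' ω) (C / (n + 1 : ℕ)) ^ α ∂P') atTop
        (𝓝 (∫ ω, H' ω ^ α ∂P')) := by
    intro f hf hfc hfb
    refine tendsto_integral_of_dominated_convergence (fun _ => (3 * C) ^ α) ?_
      (integrable_const _) ?_ ?_
    · intro n
      exact (((hfc _).measurable.comp hH').pow_const α).aestronglyMeasurable
    · intro n
      filter_upwards [hHC'] with ω hω
      obtain ⟨h1, h2⟩ := hfb _ _ hω.1 hω.2 (hδ n).le (hδ1 n)
      rw [Real.norm_of_nonneg (Real.rpow_nonneg h1 _)]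
      exact Real.rpow_le_rpow h1 h2 hα.le
    · filter_upwards [hHC'] with ω hω
      exact ((hf (H' ω) hω.1).comp hδ0).rpow_const (Or.inr hα.le)
  rw [tendsto_order]
  constructor
  · intro b hb
    have := happrox (fun x δ => max 0 (x - 2 * δ))
      (fun x hx => ?_) (fun δ => by fun_prop) (fun x δ h1 h2 h3 h4 => ?_)
    rotate_left
    · have : Continuous fun δ : ℝ => max 0 (x - 2 * δ) := by fun_prop
      simpa [hx] using this.tendsto 0
    · exact ⟨le_max_left _ _, max_le (by positivity) (by linarith)⟩
    obtain ⟨n, hn⟩ := (this.eventually (lt_mem_nhds hb)).exists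
    set δ := C / (n + 1 : ℕ) with hδdef
    -- On the support of the `i`-th tent, `x - 2δ ≤ y i ≤ x` for `x ≥ 0`. The truncated subtraction
    -- gives `y 0 = 0`, which keeps `y` nonnegative.
    let y : ℕ → ℝ := fun i => (i - 1 : ℕ) * δ
    have hy : ∀ i, 0 ≤ y i := fun i => mul_nonneg (Nat.cast_nonneg _) (hδ n).le
    have hle : ∫ ω, max 0 (H' ω - 2 * δ) ^ α ∂P' ≤
        ∫ ω, ∑ i ∈ Finset.range (n + 1 + 1), y i ^ α * tentFun δ i (H' ω) ∂P' := by
      refine integral_mono_ae (hpow (fun x => max 0 (x - 2 * δ)) (by fun_prop) C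
        fun x h1 h2 => ⟨le_max_left _ _, max_le (by positivity) (by linarith [hδ n])⟩)
        (htint _ _ _) ?_
      filter_upwards [hHC'] with ω hω
      refine le_sum_mul_tentFun (hδ n) hω.1 (hω.2.trans (hδC n)) fun i h1 h2 => ?_
      refine Real.rpow_le_rpow (le_max_left _ _) (max_le (hy i) ?_) hα.le
      have : (i : ℝ) - 1 ≤ ((i - 1 : ℕ) : ℝ) := by
        rw [sub_le_iff_le_add]; exact_mod_cast (by omega : i ≤ i - 1 + 1)
      have := mul_le_mul_of_nonneg_right this (hδ n).le
      simp only [y]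
      linarith
    filter_upwards [(key (n + 1) y hy δ).eventually (lt_mem_nhds (hn.trans_le hle)),
      eventually_ge_atTop 0] with u hu hu0
    refine hu.trans_le (div_le_div_of_nonneg_right ?_ (hG u).le)
    rw [hsum, hreal]
    refine integral_mono (hsint _ _ _ _) (hiint u) fun ω => ?_
    refine sum_mul_tentFun_le (hδ n) (hHC ω).1 ((hHC ω).2.trans (hδC n))
      fun i h1 h2 => ?_
    by_cases hω : u < N ω * y i
    · have : u < N ω * H ω := by
        refine hω.trans_le (mul_le_mul_of_nonneg_left ?_ (hN0 ω))
        rcases Nat.eq_zero_or_pos i with hi | hi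
        · simp [y, hi, (hHC ω).1]
        · simp only [y]; push_cast [Nat.cast_sub hi]; exact h2.le
      simp [Set.indicator, hω, this]
    · simp only [Set.indicator, Set.mem_ofPred_eq, hω, if_false]
      split_ifs <;> simp
  · intro b hb
    have := happrox (fun x δ => x + 2 * δ)
      (fun x hx => ?_) (fun δ => by fun_prop) (fun x δ h1 h2 h3 h4 => ⟨by positivity, by linarith⟩)
    rotate_left
    · have : Continuous fun δ : ℝ => x + 2 * δ := by fun_prop
      simpa using this.tendsto 0
    obtain ⟨n, hn⟩ := (this.eventually (gt_mem_nhds hb)).exists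
    set δ := C / (n + 1 : ℕ) with hδdef
    -- On the support of the `i`-th tent, `x ≤ y i ≤ x + 2δ`.
    let y : ℕ → ℝ := fun i => (i + 1) * δ
    have hδp := hδ n
    have hy : ∀ i, 0 ≤ y i := fun i => by simp only [y]; positivity
    have hle : ∫ ω, ∑ i ∈ Finset.range (n + 1 + 1), y i ^ α * tentFun δ i (H' ω) ∂P' ≤
        ∫ ω, (H' ω + 2 * δ) ^ α ∂P' := by
      refine integral_mono_ae (htint _ _ _) (hpow (fun x => x + 2 * δ) (by fun_prop) (C + 2 * δ)
        fun x h1 h2 => ⟨by positivity, by linarith⟩) ?_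
      filter_upwards [hHC'] with ω hω
      refine sum_mul_tentFun_le (hδ n) hω.1 (hω.2.trans (hδC n)) fun i h1 h2 => ?_
      refine Real.rpow_le_rpow (hy i) ?_ hα.le
      simp only [y]
      linarith
    filter_upwards [(key (n + 1) y hy δ).eventually (gt_mem_nhds (hle.trans_lt hn)),
      eventually_ge_atTop 0] with u hu hu0
    refine (div_le_div_of_nonneg_right ?_ (hG u).le).trans_lt hu
    rw [hsum, hreal]
    refine integral_mono (hiint u) (hsint _ _ _ _) fun ω => ?_
    refine le_sum_mul_tentFun (hδ n) (hHC ω).1 ((hHC ω).2.trans (hδC n)) fun i h1 h2 => ?_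
    by_cases hω : u < N ω * H ω
    · have : u < N ω * y i :=
        hω.trans_le (mul_le_mul_of_nonneg_left h1.le (hN0 ω))
      simp [Set.indicator, hω, this]
    · simp only [Set.indicator, Set.mem_ofPred_eq, hω, if_false]
      split_ifs <;> simp

end Product

/-! ### Homogeneity of the norm and of risk functionals -/

/-- A bounded action gives only `≤`; applying this to `c⁻¹` and `c • x` gives the converse. -/
lemma dist_nnreal_smul_zero {E : Type*} [PseudoMetricSpace E] [Zero E] [MulActionWithZero ℝ≥0 E]
    [IsBoundedSMul ℝ≥0 E] (c : ℝ≥0) (x : E) : dist (c • x) 0 = c * dist x 0 := by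
  have key : ∀ (c : ℝ≥0) (x : E), dist (c • x) 0 ≤ c * dist x 0 := by
    intro c x
    have := dist_smul_pair c x (0 : E)
    rwa [smul_zero, NNReal.dist_eq, NNReal.coe_zero, sub_zero, NNReal.abs_eq] at this
  rcases eq_or_ne c 0 with rfl | hc
  · simp
  refine le_antisymm (key c x) ?_
  have h := key c⁻¹ (c • x)
  rw [inv_smul_smul₀ hc, NNReal.coe_inv] at h
  have hc' : (0 : ℝ) < c := by positivity
  rw [inv_mul_eq_div, le_div_iff₀ hc'] at h
  linarith

lemma IsRiskFunctional.map_zero {K : Type*} [TopologicalSpace K]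
    {r : CPlus K → ℝ≥0} (hr : IsRiskFunctional r) : r 0 = 0 := by
  simpa using hr.homogeneous 0 0

section

variable {K : Type*} [TopologicalSpace K] [CompactSpace K]

lemma supNorm_smul (c : ℝ≥0) (f : CPlus K) : supNorm (c • f) = c * supNorm f :=
  dist_nnreal_smul_zero c f

lemma supNorm_nonneg (f : CPlus K) : 0 ≤ supNorm f := dist_nonneg

lemma continuous_supNorm : Continuous (supNorm : CPlus K → ℝ) := by
  unfold supNorm; fun_prop

lemma boundedAway_norm_gt {T : Finset ℤ} {y : ℝ} (hy : 0 < y) :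
    BoundedAway {z : T → CPlus K | y < dist z 0} := ⟨y, hy, fun _ hx => le_of_lt hx⟩

/-- A risk functional is dominated by a multiple of the supremum norm. -/
lemma IsRiskFunctional.exists_bound {r : CPlus K → ℝ≥0} (hr : IsRiskFunctional r) :
    ∃ C : ℝ, 0 < C ∧ ∀ f, (r f : ℝ) ≤ C * supNorm f := by
  have h0 : ∀ᶠ f in 𝓝 (0 : CPlus K), r f < 1 := by
    refine hr.continuous.continuousAt.eventually_lt_const ?_
    rw [hr.map_zero]; exact one_pos
  obtain ⟨δ, hδ, hb⟩ := Metric.eventually_nhds_iff.1 h0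
  -- Since `r < 1` on the ball of radius `δ`, rescaling `f` to norm `δ / 2` gives the constant `2 /
  -- δ`.
  refine ⟨2 / δ, by positivity, fun f => ?_⟩
  rcases (supNorm_nonneg f).eq_or_lt with hf | hf
  · have : f = 0 := dist_eq_zero.1 hf.symm
    rw [← hf, this, hr.map_zero]; simp
  · set c : ℝ≥0 := (δ / (2 * supNorm f)).toNNReal with hc
    have hcv : (c : ℝ) = δ / (2 * supNorm f) := Real.coe_toNNReal _ (by positivity)
    have h1 : r (c • f) < 1 := by
      apply hb
      change supNorm (c • f) < δ
      rw [supNorm_smul, hcv]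
      field_simp
      norm_num
    rw [hr.homogeneous] at h1
    have h2 : (c : ℝ) * r f < 1 := by exact_mod_cast h1
    rw [hcv, div_mul_eq_mul_div, div_lt_one (by positivity)] at h2
    rw [div_mul_eq_mul_div, le_div_iff₀ hδ]
    linarith

end

/-! ### Regular variation of the norm -/

section Tail

variable {K : Type*} [TopologicalSpace K] [CompactSpace K] [MeasurableSpace (CPlus K)]
  [BorelSpace (CPlus K)] [SecondCountableTopology (CPlus K)]
  {Ω : Type*} [MeasurableSpace Ω] {P : Measure Ω} {X : ℤ → Ω → CPlus K} {α : ℝ}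

/-- The tail function of `‖X₀‖`. -/
def normTail (P : Measure Ω) (X : ℤ → Ω → CPlus K) (u : ℝ) : ℝ :=
  P.real {ω | u < supNorm (X 0 ω)}

/-- The exponent measure of the complement of the ball of radius `y`. -/
lemma IsExponentMeasure.apply_norm_gt {T : Finset ℤ} {a : ℕ → ℝ≥0} {μ : Measure (T → CPlus K)}
    (h : IsExponentMeasure P X α T a μ) {y : ℝ≥0} (hy : 0 < y) :
    μ {z | (y : ℝ) < dist z 0} = ENNReal.ofReal ((y : ℝ) ^ (-α)) * μ {z | 1 < dist z 0} := by
  rw [← h.homogeneous y hy _ (measurableSet_lt measurable_const (by fun_prop))]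
  congr 1
  ext z
  have hy' : (0 : ℝ) < y := by exact_mod_cast hy
  rw [Set.mem_smul_set_iff_inv_smul_mem₀ hy.ne']
  simp only [Set.mem_ofPred_eq]
  rw [dist_nnreal_smul_zero, NNReal.coe_inv, inv_mul_eq_div, lt_div_iff₀ hy', one_mul]

/-- Otherwise homogeneity would make the complement of every ball null; these exhaust the space
without the origin, so `μ` would vanish. -/
lemma IsExponentMeasure.norm_gt_one_pos {T : Finset ℤ} {a : ℕ → ℝ≥0} {μ : Measure (T → CPlus K)}
    (h : IsExponentMeasure P X α T a μ) : 0 < μ {z | 1 < dist z 0} := by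
  rw [pos_iff_ne_zero]
  intro h0
  refine h.ne_zero (Measure.measure_univ_eq_zero.1 ?_)
  have hcover : (Set.univ : Set (T → CPlus K)) ⊆
      {0} ∪ ⋃ n : ℕ, {z | (((n : ℝ≥0) + 1)⁻¹ : ℝ≥0) < dist z 0} := by
    intro z _
    by_cases hz : z = 0
    · exact Or.inl hz
    · right
      obtain ⟨n, hn⟩ := exists_nat_one_div_lt (dist_pos.2 hz)
      exact Set.mem_iUnion.2 ⟨n, by simpa using hn⟩
  refine measure_mono_null hcover (measure_union_null h.origin (measure_iUnion_null fun n => ?_))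
  rw [h.apply_norm_gt (by positivity), h0, mul_zero]

/-- For `x < y` the sphere of radius `y` and its exterior lie in `{x < dist z 0}`, whose measure `x
^ (-α) * μ {1 < dist z 0}` tends, as `x ↑ y`, to that of the exterior alone. Thus sets `{y < dist z
0}` are continuity sets. -/
lemma IsExponentMeasure.sphere_null {T : Finset ℤ} {a : ℕ → ℝ≥0}
    {μ : Measure (T → CPlus K)} (h : IsExponentMeasure P X α T a μ) {y : ℝ≥0} (hy : 0 < y) :
    μ {z | dist z 0 = y} = 0 := by
  have hy' : (0 : ℝ) < y := by exact_mod_cast hy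
  have hfin : ∀ y : ℝ≥0, 0 < y → μ {z | (y : ℝ) < dist z 0} < ∞ := fun y hy =>
    h.finite _ (measurableSet_lt measurable_const (by fun_prop)) (boundedAway_norm_gt hy)
  have hle : ∀ x : ℝ, 0 < x → x < y →
      μ {z | dist z 0 = y} + μ {z | (y : ℝ) < dist z 0}
        ≤ ENNReal.ofReal (x ^ (-α)) * μ {z | 1 < dist z 0} := by
    intro x hx hxy
    have h1 := h.apply_norm_gt (y := x.toNNReal) (Real.toNNReal_pos.2 hx)
    rw [Real.coe_toNNReal _ hx.le] at h1
    rw [← h1, ← measure_union]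
    · refine measure_mono ?_
      rintro z (hz | hz)
      · exact hxy.trans_eq (Eq.symm hz)
      · exact hxy.trans hz
    · exact Set.disjoint_left.2 fun z (hz : _ = _) (hz' : _ < _) => hz'.ne' hz
    · exact measurableSet_lt measurable_const (by fun_prop)
  have hlim : Tendsto (fun x : ℝ => ENNReal.ofReal (x ^ (-α)) * μ {z | 1 < dist z 0}) (𝓝[<] y)
      (𝓝 (ENNReal.ofReal ((y : ℝ) ^ (-α)) * μ {z | 1 < dist z 0})) := by
    have hc : ContinuousAt (fun x : ℝ => x ^ (-α)) y :=
      Real.continuousAt_rpow_const _ _ (Or.inl hy'.ne')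
    refine ENNReal.Tendsto.mul_const (ENNReal.tendsto_ofReal (hc.tendsto.mono_left
      nhdsWithin_le_nhds)) (Or.inr ?_)
    exact (by simpa using hfin 1 one_pos : μ {z | 1 < dist z 0} < ∞).ne
  have hev : ∀ᶠ x : ℝ in 𝓝[<] (y : ℝ), μ {z | dist z 0 = y} + μ {z | (y : ℝ) < dist z 0}
        ≤ ENNReal.ofReal (x ^ (-α)) * μ {z | 1 < dist z 0} := by
    filter_upwards [Ioo_mem_nhdsLT hy'] with x hx using hle x hx.1 hx.2
  have := ge_of_tendsto hlim hev
  rw [← h.apply_norm_gt hy] at this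
  have h2 : μ {z | dist z 0 = y} + μ {z | (y : ℝ) < dist z 0}
      ≤ 0 + μ {z | (y : ℝ) < dist z 0} := by rwa [zero_add]
  exact le_antisymm ((ENNReal.add_le_add_iff_right (hfin y hy).ne).1 h2) zero_le

/-- The norm of a regularly varying time series has a regularly varying tail. -/
lemma IsRegularlyVarying.normTail_ratio [IsProbabilityMeasure P]
    (hX : IsRegularlyVarying P X α) : (∀ u, 0 < normTail P X u) ∧
      ∀ y : ℝ, 0 < y →
        Tendsto (fun u => normTail P X (u * y) / normTail P X u) atTop (𝓝 (y ^ (-α))) := by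
  obtain ⟨a, μ, h⟩ := hX.exists_exponentMeasure {0} (Finset.singleton_nonempty 0)
  set c := μ {z | 1 < dist z 0} with hc
  have hcfin : c < ∞ :=
    h.finite _ (measurableSet_lt measurable_const (by fun_prop)) (boundedAway_norm_gt one_pos)
  have hat : Tendsto (fun n => (a n : ℝ)) atTop atTop :=
    NNReal.tendsto_coe_atTop.2 h.tendsto_atTop
  refine tendsto_tail_ratio (c := c.toReal) (a := fun n => (a n : ℝ)) ?_
    (fun u => measureReal_nonneg) (fun i j hij => NNReal.coe_le_coe.2 (h.monotone hij)) hat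
    (ENNReal.toReal_pos h.norm_gt_one_pos.ne' hcfin.ne) ?_
  · intro u v huv
    exact measureReal_mono fun ω hω => lt_of_le_of_lt huv hω
  · intro y hy
    have h1 := h.apply_norm_gt (y := y.toNNReal) (Real.toNNReal_pos.2 hy)
    have h0 := h.sphere_null (y := y.toNNReal) (Real.toNNReal_pos.2 hy)
    rw [Real.coe_toNNReal _ hy.le] at h1 h0
    have hfr : μ (frontier {z | y < dist z 0}) = 0 := by
      refine measure_mono_null ?_ h0
      intro z hz
      exact (frontier_lt_subset_eq continuous_const (by fun_prop) hz).symm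
    have ht := h.tendsto _ (measurableSet_lt measurable_const (by fun_prop))
      (boundedAway_norm_gt hy) hfr
    rw [h1] at ht
    have ht' := (ENNReal.tendsto_toReal
      (ENNReal.mul_ne_top ENNReal.ofReal_ne_top hcfin.ne)).comp ht
    rw [ENNReal.toReal_mul, ENNReal.toReal_ofReal (by positivity), mul_comm] at ht'
    refine ht'.congr' ?_
    filter_upwards [hat.eventually (eventually_gt_atTop 0)] with n hn
    simp only [Function.comp_apply, ENNReal.toReal_mul, ENNReal.toReal_natCast]
    congr 1
    change P.real _ = _
    congr 1
    ext ω
    have hd : dist (fun t : ({0} : Finset ℤ) => (a n)⁻¹ • X t ω) 0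
        = (a n : ℝ)⁻¹ * supNorm (X 0 ω) := by
      rw [← NNReal.coe_inv, ← supNorm_smul]
      refine le_antisymm ((dist_pi_le_iff dist_nonneg).2 fun t => ?_) ?_
      · have : (t : ℤ) = 0 := Finset.mem_singleton.1 t.2
        rw [this]; rfl
      · exact dist_le_pi_dist (fun t : ({0} : Finset ℤ) => (a n)⁻¹ • X t ω) 0
          ⟨0, Finset.mem_singleton_self 0⟩
    simp only [Set.mem_ofPred_eq]
    rw [hd, inv_mul_eq_div, lt_div_iff₀ hn, mul_comm]

end Tail

/-! ### Homogeneous functionals of finitely many coordinates -/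

/-- A continuous `1`-homogeneous functional of a time series that depends on finitely many time
points. -/
structure IsTailFunctional {K : Type*} [TopologicalSpace K] (h : (ℤ → CPlus K) → ℝ≥0) :
    Prop where
  continuous : Continuous h
  homogeneous : ∀ (c : ℝ≥0) (x : ℤ → CPlus K), h (c • x) = c * h x
  exists_finset : ∃ T : Finset ℤ, ∀ x y : ℤ → CPlus K, (∀ t ∈ T, x t = y t) → h x = h y

namespace IsTailFunctional

variable {K : Type*} [TopologicalSpace K] {h h' : (ℤ → CPlus K) → ℝ≥0}

lemma eval {r : CPlus K → ℝ≥0} (hr : IsRiskFunctional r) (t : ℤ) :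
    IsTailFunctional fun x : ℤ → CPlus K => r (x t) where
  continuous := hr.continuous.comp (continuous_apply t)
  homogeneous c x := hr.homogeneous c (x t)
  exists_finset := ⟨{t}, fun x y hxy => by rw [hxy t (Finset.mem_singleton_self t)]⟩

lemma min (hh : IsTailFunctional h) (hh' : IsTailFunctional h') :
    IsTailFunctional fun x => min (h x) (h' x) where
  continuous := hh.continuous.min hh'.continuous
  homogeneous c x := by
    rw [hh.homogeneous, hh'.homogeneous, mul_min]
  exists_finset := by
    classical
    obtain ⟨T, hT⟩ := hh.exists_finset
    obtain ⟨T', hT'⟩ := hh'.exists_finset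
    exact ⟨T ∪ T', fun x y hxy => by
      rw [hT x y fun t ht => hxy t (Finset.mem_union_left _ ht),
        hT' x y fun t ht => hxy t (Finset.mem_union_right _ ht)]⟩

lemma max (hh : IsTailFunctional h) (hh' : IsTailFunctional h') :
    IsTailFunctional fun x => max (h x) (h' x) where
  continuous := hh.continuous.max hh'.continuous
  homogeneous c x := by
    rw [hh.homogeneous, hh'.homogeneous, mul_max]
  exists_finset := by
    classical
    obtain ⟨T, hT⟩ := hh.exists_finset
    obtain ⟨T', hT'⟩ := hh'.exists_finset
    exact ⟨T ∪ T', fun x y hxy => by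
      rw [hT x y fun t ht => hxy t (Finset.mem_union_left _ ht),
        hT' x y fun t ht => hxy t (Finset.mem_union_right _ ht)]⟩

end IsTailFunctional

/-- The minimum of the risks at the times `0, …, ℓ - 1` (at time `0` if `ℓ = 0`). -/
def minRisk {K : Type*} [TopologicalSpace K] (r : CPlus K → ℝ≥0) (ℓ : ℕ) (x : ℤ → CPlus K) :
    ℝ≥0 :=
  (Finset.Ico 1 ℓ).fold min (r (x 0)) fun i : ℕ => r (x i)

lemma isTailFunctional_minRisk {K : Type*} [TopologicalSpace K] {r : CPlus K → ℝ≥0}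
    (hr : IsRiskFunctional r) (ℓ : ℕ) : IsTailFunctional (minRisk r ℓ) := by
  classical
  unfold minRisk
  induction Finset.Ico 1 ℓ using Finset.induction_on with
  | empty => simpa using IsTailFunctional.eval hr 0
  | insert i s hi ih =>
    simp only [Finset.fold_insert hi]
    exact (IsTailFunctional.eval hr i).min ih

lemma minRisk_le {K : Type*} [TopologicalSpace K] (r : CPlus K → ℝ≥0) (ℓ : ℕ)
    (x : ℤ → CPlus K) : minRisk r ℓ x ≤ r (x 0) :=
  (Finset.fold_min_le _).2 (Or.inl le_rfl)

/-- Extension of a finite family of functions to a time series, by zero. -/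
def extendZero {K : Type*} [TopologicalSpace K] {T : Finset ℤ} (z : T → CPlus K) (t : ℤ) :
    CPlus K := if h : t ∈ T then z ⟨t, h⟩ else 0

lemma continuous_extendZero {K : Type*} [TopologicalSpace K] {T : Finset ℤ} :
    Continuous (extendZero : (T → CPlus K) → ℤ → CPlus K) := by
  refine continuous_pi fun t => ?_
  by_cases h : t ∈ T
  · simpa [extendZero, h] using continuous_apply _
  · simpa [extendZero, h] using continuous_const

/-! ### Tail limits -/

/-- A mixed event thereby becomes a difference of two nested tail events, of `m` and of `min m M`;
`rpow_sub_min_rpow` is the matching identity for the limits. -/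
lemma and_le_iff_not_lt_min {u m M : ℝ} : (u < m ∧ M ≤ u) ↔ u < m ∧ ¬ u < min m M := by
  rw [lt_min_iff]
  constructor
  · exact fun ⟨h1, h2⟩ => ⟨h1, fun h => not_lt.2 h2 h.2⟩
  · exact fun ⟨h1, h2⟩ => ⟨h1, not_lt.1 fun h => h2 ⟨h1, h⟩⟩

lemma rpow_sub_min_rpow {α : ℝ} {m M : ℝ≥0} (hα : 0 < α) :
    (m : ℝ) ^ α - ((min m M : ℝ≥0) : ℝ) ^ α = max ((m : ℝ) ^ α - (M : ℝ) ^ α) 0 := by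
  rcases le_total m M with h | h
  · rw [min_eq_left h, sub_self, max_eq_right]
    exact sub_nonpos.2 (Real.rpow_le_rpow m.2 h hα.le)
  · rw [min_eq_right h, max_eq_left]
    exact sub_nonneg.2 (Real.rpow_le_rpow M.2 h hα.le)

section Limit

variable {K : Type*} [TopologicalSpace K] [CompactSpace K] [MeasurableSpace (CPlus K)]
  [BorelSpace (CPlus K)] [SecondCountableTopology (CPlus K)]
  {Ω Ω' : Type*} [MeasurableSpace Ω] [MeasurableSpace Ω'] {P : Measure Ω} {P' : Measure Ω'}
  [IsProbabilityMeasure P']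
  {X : ℤ → Ω → CPlus K} {Θ : ℤ → Ω' → CPlus K} {α : ℝ} {r : CPlus K → ℝ≥0}

/-- As `‖Θ₀‖ = 1` almost surely, `h(Θ) ≤ r(Θ₀)` is bounded. -/
lemma integrable_functional (hα : 0 < α) (hΘ : IsSpectralTailProcess P X P' Θ)
    (hr : IsRiskFunctional r)
    {h : (ℤ → CPlus K) → ℝ≥0} (hh : IsTailFunctional h) (hle : ∀ x, h x ≤ r (x 0)) :
    Integrable (fun ω => (h (fun t => Θ t ω) : ℝ) ^ α) P' := by
  obtain ⟨C, hC, hrC⟩ := hr.exists_bound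
  refine integrable_of_ae_mem_Icc (C := C ^ α) ?_ ?_
  · exact ((hh.continuous.measurable.comp
      (measurable_pi_lambda _ hΘ.measurable)).coe_nnreal_real).pow_const α
  · filter_upwards [hΘ.norm_zero] with ω hω
    refine ⟨by positivity, Real.rpow_le_rpow (NNReal.coe_nonneg _) ?_ hα.le⟩
    calc (h (fun t => Θ t ω) : ℝ) ≤ r (Θ 0 ω) := by exact_mod_cast hle _
      _ ≤ C * supNorm (Θ 0 ω) := hrC _
      _ = C := by rw [hω, mul_one]

variable [IsProbabilityMeasure P]

/-- The tail of a homogeneous functional of a regularly varying time series, relative to the tail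
of `‖X₀‖`. -/
lemma tendsto_tail_functional (hα : 0 < α) (hX : IsRegularlyVarying P X α)
    (hΘ : IsSpectralTailProcess P X P' Θ) (hr : IsRiskFunctional r)
    {h : (ℤ → CPlus K) → ℝ≥0} (hh : IsTailFunctional h) (hle : ∀ x, h x ≤ r (x 0)) :
    Tendsto (fun u : ℝ => P.real {ω | u < (h fun t => X t ω)} / normTail P X u) atTop
      (𝓝 (∫ ω, (h (fun t => Θ t ω) : ℝ) ^ α ∂P')) := by
  obtain ⟨C, hC, hrC⟩ := hr.exists_bound
  obtain ⟨hG, hGr⟩ := hX.normTail_ratio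
  obtain ⟨T, hT⟩ := hh.exists_finset
  have hXm := hX.stationary.measurable
  have hhm : Measurable fun x => (h x : ℝ) := hh.continuous.measurable.coe_nnreal_real
  set N : Ω → ℝ := fun ω => supNorm (X 0 ω) with hN
  have hNm : Measurable N := continuous_supNorm.measurable.comp (hXm 0)
  have hN0 : ∀ ω, 0 ≤ N ω := fun ω => supNorm_nonneg _
  set Z : Ω → ℤ → CPlus K := fun ω => (N ω).toNNReal⁻¹ • fun t => X t ω with hZ
  have hZm : Measurable Z := measurable_pi_lambda _ fun t =>
    (hNm.real_toNNReal.inv).smul (hXm t)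
  -- Where `X₀ = 0`, the domination `h ≤ r(X₀) = 0` makes both sides vanish.
  have hprod : ∀ ω, ((h fun t => X t ω : ℝ≥0) : ℝ) = N ω * h (Z ω) := by
    intro ω
    rcases (hN0 ω).eq_or_lt with h0 | h0
    · have hx : X 0 ω = 0 := dist_eq_zero.1 h0.symm
      have := hle fun t => X t ω
      rw [hx, hr.map_zero] at this
      rw [← h0, zero_mul, le_antisymm this zero_le, NNReal.coe_zero]
    · rw [hZ, hh.homogeneous, NNReal.coe_mul, NNReal.coe_inv, Real.coe_toNNReal _ h0.le,
        mul_inv_cancel_left₀ h0.ne']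
  simp_rw [hprod]
  refine tendsto_tail_mul (H' := fun ω => (h (fun t => Θ t ω) : ℝ)) hα hC hNm hN0
    (hhm.comp hZm) (hhm.comp (measurable_pi_lambda _ hΘ.measurable))
    (fun ω => ⟨NNReal.coe_nonneg _, ?_⟩) ?_ hG ?_
  · calc (h (Z ω) : ℝ) ≤ r (Z ω 0) := by exact_mod_cast hle _
      _ ≤ C * supNorm (Z ω 0) := hrC _
      _ = C * ((N ω)⁻¹ * N ω) := by
        rw [show Z ω 0 = (N ω).toNNReal⁻¹ • X 0 ω from rfl, supNorm_smul,
          NNReal.coe_inv, Real.coe_toNNReal _ (hN0 ω)]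
      _ ≤ C * 1 := mul_le_mul_of_nonneg_left (inv_mul_le_one) hC.le
      _ = C := mul_one C
  · filter_upwards [hΘ.norm_zero] with ω hω
    refine ⟨NNReal.coe_nonneg _, ?_⟩
    calc (h (fun t => Θ t ω) : ℝ) ≤ r (Θ 0 ω) := by exact_mod_cast hle _
      _ ≤ C * supNorm (Θ 0 ω) := hrC _
      _ = C := by rw [hω, mul_one]
  · intro y hy g
    rcases hy.eq_or_lt with rfl | hy
    · rw [Real.zero_rpow hα.ne', zero_mul]
      refine tendsto_const_nhds.congr' ?_
      filter_upwards [eventually_ge_atTop 0] with u hu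
      simp [not_lt.2 hu]
    -- Weak convergence is available for finite families only; `extendZero` lets `h` act on the
    -- coordinates in `T`.
    have hext : ∀ x : ℤ → CPlus K, h (extendZero fun t : T => x t) = h x := fun x =>
      hT _ _ fun t ht => by simp [extendZero, ht]
    have hlim := hΘ.tendsto T (g.compContinuous ⟨fun z : T → CPlus K => (h (extendZero z) : ℝ),
      NNReal.continuous_coe.comp (hh.continuous.comp continuous_extendZero)⟩)
    simp only [BoundedContinuousFunction.compContinuous_apply, ContinuousMap.coe_mk] at hlim
    have e1 : ∀ ω, h (extendZero fun t : T => Θ t ω) = h fun t => Θ t ω := fun ω =>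
      hext fun t => Θ t ω
    have e2 : ∀ ω, h (extendZero fun t : T => (supNorm (X 0 ω)).toNNReal⁻¹ • X t ω) = h (Z ω) :=
      fun ω => hext (Z ω)
    simp_rw [e1, e2] at hlim
    have hdiv : Tendsto (fun u : ℝ => u * y⁻¹) atTop atTop :=
      tendsto_id.atTop_mul_const (inv_pos.2 hy)
    -- The event is `‖X₀‖ > u / y`: its probability over `G u` tends to `y ^ α`, and the conditional
    -- expectation on it tends to that of the spectral process.
    have := (hGr y⁻¹ (inv_pos.2 hy)).mul (hlim.comp hdiv)
    rw [Real.inv_rpow hy.le, Real.rpow_neg hy.le, inv_inv] at this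
    refine this.congr fun u => ?_
    have hset : {ω | u < N ω * y} = {ω | u * y⁻¹ < supNorm (X 0 ω)} := by
      ext ω
      simp only [Set.mem_ofPred_eq, ← div_eq_mul_inv, div_lt_iff₀ hy, hN]
    rw [hset]
    have hpos := hG (u * y⁻¹)
    simp only [Function.comp_apply]
    rw [ProbabilityTheory.cond, integral_smul_measure, ENNReal.toReal_inv, smul_eq_mul]
    change normTail P X (u * y⁻¹) / normTail P X u * ((normTail P X (u * y⁻¹))⁻¹ * _) = _
    rw [← mul_assoc, div_mul_eq_mul_div, mul_inv_cancel₀ hpos.ne', one_div_mul_eq_div]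

/-- The probability that one homogeneous functional exceeds a high threshold while another one
does not, relative to the tail of `‖X₀‖`. -/
lemma tendsto_tail_functional_and (hα : 0 < α) (hX : IsRegularlyVarying P X α)
    (hΘ : IsSpectralTailProcess P X P' Θ) (hr : IsRiskFunctional r)
    {m M : (ℤ → CPlus K) → ℝ≥0} (hm : IsTailFunctional m) (hM : IsTailFunctional M)
    (hle : ∀ x, m x ≤ r (x 0)) :
    Tendsto (fun u : ℝ => P.real {ω | u < (m fun t => X t ω) ∧ (M fun t => X t ω) ≤ u}
      / normTail P X u) atTop
      (𝓝 (∫ ω, max ((m (fun t => Θ t ω) : ℝ) ^ α - (M (fun t => Θ t ω) : ℝ) ^ α) 0 ∂P')) := by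
  have hmin := hm.min hM
  have hle' : ∀ x, min (m x) (M x) ≤ r (x 0) := fun x => (min_le_left _ _).trans (hle x)
  have h1 := (tendsto_tail_functional hα hX hΘ hr hm hle).sub
    (tendsto_tail_functional hα hX hΘ hr hmin hle')
  rw [← integral_sub (integrable_functional hα hΘ hr hm hle)
    (integrable_functional hα hΘ hr hmin hle')] at h1
  simp_rw [rpow_sub_min_rpow hα] at h1
  refine h1.congr fun u => ?_
  rw [← sub_div, ← measureReal_sdiff]
  · congr 2
    ext ω
    simp only [Set.mem_sdiff, Set.mem_ofPred_eq, NNReal.coe_min]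
    exact and_le_iff_not_lt_min.symm
  · intro ω hω
    simp only [Set.mem_ofPred_eq, NNReal.coe_min, lt_min_iff] at hω
    exact hω.1
  · exact measurableSet_lt measurable_const ((hmin.continuous.measurable.comp
      (measurable_pi_lambda _ hX.stationary.measurable)).coe_nnreal_real)

end Limit

/-! ### The Pareto law -/

lemma paretoMeasure_real_Ioi {α a : ℝ} (hα : 0 < α) (ha : 1 ≤ a) :
    (paretoMeasure 1 α).real (Set.Ioi a) = a ^ (-α) := by
  have h0 : 0 < a := one_pos.trans_le ha
  rw [measureReal_def, paretoMeasure, withDensity_apply _ measurableSet_Ioi,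
    setLIntegral_congr_fun (g := fun x => ENNReal.ofReal (α * x ^ (-(α + 1)))) measurableSet_Ioi
      fun x hx => by
        rw [paretoPDF_of_le (ha.trans (le_of_lt hx)), Real.one_rpow, mul_one],
    ← integral_eq_lintegral_of_nonneg_ae]
  · rw [integral_const_mul, integral_Ioi_rpow_of_lt (by linarith) h0]
    have : -(α + 1) + 1 = -α := by ring
    rw [this]
    field_simp
  · rw [EventuallyLE, ae_restrict_iff' measurableSet_Ioi]
    filter_upwards with x hx
    have : 0 < x := h0.trans hx
    simp only [Pi.zero_apply]
    positivity
  · exact (measurable_const.mul (measurable_id.pow_const _)).aestronglyMeasurable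

/-- The event is `v > 1 / x`, and `x ≤ 1` puts `1 / x` into the range `[1, ∞)` where the tail is a
pure power. -/
lemma paretoMeasure_one_lt_mul {α : ℝ} (hα : 0 < α) {x : ℝ≥0} (hx : x ≤ 1) :
    paretoMeasure 1 α {v | 1 < v * (x : ℝ)} = ENNReal.ofReal ((x : ℝ) ^ α) := by
  have := isProbabilityMeasure_paretoMeasure one_pos hα
  rcases eq_or_ne x 0 with rfl | h0
  · simp [Real.zero_rpow hα.ne', not_lt.2 (zero_le_one' ℝ)]
  have hx0 : (0 : ℝ) < x := by positivity
  have hset : {v : ℝ | 1 < v * (x : ℝ)} = Set.Ioi (x : ℝ)⁻¹ := by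
    ext v
    simp only [Set.mem_ofPred_eq, Set.mem_Ioi, inv_lt_iff_one_lt_mul₀ hx0]
  have hx1 : (1 : ℝ) ≤ (x : ℝ)⁻¹ := (one_le_inv₀ hx0).2 (by exact_mod_cast hx)
  rw [hset, ← ofReal_measureReal, paretoMeasure_real_Ioi hα hx1, Real.inv_rpow hx0.le,
    Real.rpow_neg hx0.le, inv_inv]

section Pareto

variable {E : Type*} [MeasurableSpace E] {Q : Measure E} [IsProbabilityMeasure Q] {α : ℝ}

lemma pareto_prod_one_lt_mul (hα : 0 < α) {h : E → ℝ≥0} (hm : Measurable h)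
    (hle : ∀ᵐ θ ∂Q, h θ ≤ 1) :
    ((paretoMeasure 1 α).prod Q).real {p | 1 < p.1 * (h p.2 : ℝ)} = ∫ θ, (h θ : ℝ) ^ α ∂Q := by
  have := isProbabilityMeasure_paretoMeasure one_pos hα
  rw [measureReal_def, Measure.prod_apply_symm, integral_eq_lintegral_of_nonneg_ae]
  · congr 1
    refine lintegral_congr_ae ?_
    filter_upwards [hle] with θ hθ
    exact paretoMeasure_one_lt_mul hα hθ
  · exact Eventually.of_forall fun θ => by positivity
  · exact (hm.coe_nnreal_real.pow_const α).aestronglyMeasurable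
  · exact measurableSet_lt measurable_const
      (measurable_fst.mul (hm.comp measurable_snd).coe_nnreal_real)

/-- The probability that a Pareto variable, scaled by one of two independent factors, exceeds `1`,
and scaled by the other one does not. -/
lemma pareto_prod_and (hα : 0 < α) {m M : E → ℝ≥0} (hm : Measurable m) (hM : Measurable M)
    (hle : ∀ᵐ θ ∂Q, m θ ≤ 1) :
    ((paretoMeasure 1 α).prod Q).real {p | 1 < p.1 * (m p.2 : ℝ) ∧ p.1 * (M p.2 : ℝ) ≤ 1}
      = ∫ θ, max ((m θ : ℝ) ^ α - (M θ : ℝ) ^ α) 0 ∂Q := by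
  have := isProbabilityMeasure_paretoMeasure one_pos hα
  have hmin : Measurable fun θ => min (m θ) (M θ) := hm.min hM
  have hle' : ∀ᵐ θ ∂Q, min (m θ) (M θ) ≤ 1 := by
    filter_upwards [hle] with θ hθ using (min_le_left _ _).trans hθ
  have hint : ∀ h : E → ℝ≥0, Measurable h → (∀ᵐ θ ∂Q, h θ ≤ 1) →
      Integrable (fun θ => (h θ : ℝ) ^ α) Q := by
    intro h hh hh1
    refine integrable_of_ae_mem_Icc (C := 1) (hh.coe_nnreal_real.pow_const α) ?_
    filter_upwards [hh1] with θ hθ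
    exact ⟨by positivity, Real.rpow_le_one (NNReal.coe_nonneg _) (by exact_mod_cast hθ) hα.le⟩
  simp_rw [← rpow_sub_min_rpow hα]
  rw [integral_sub (hint m hm hle) (hint _ hmin hle'), ← pareto_prod_one_lt_mul hα hm hle,
    ← pareto_prod_one_lt_mul hα hmin hle', ← measureReal_sdiff]
  · congr 1
    ext ⟨v, θ⟩
    simp only [Set.mem_sdiff, Set.mem_ofPred_eq, NNReal.coe_min]
    -- The product space contains `v ≤ 0`, where multiplication by `v` does not commute with `min`;
    -- the events are empty there.
    rcases le_or_gt v 0 with hv | hv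
    · have : ¬ 1 < v * (m θ : ℝ) := by
        have := mul_nonpos_of_nonpos_of_nonneg hv (m θ).2
        exact not_lt.2 (this.trans zero_le_one)
      simp [this]
    · rw [mul_min_of_nonneg _ _ hv.le]
      exact and_le_iff_not_lt_min
  · rintro ⟨v, θ⟩ hp
    simp only [Set.mem_ofPred_eq, NNReal.coe_min] at hp ⊢
    have hv : 0 < v := by
      by_contra! hv
      have := mul_nonpos_of_nonpos_of_nonneg hv (le_min (m θ).2 (M θ).2)
      exact absurd (hp.trans_le this) (by norm_num)
    exact hp.trans_le (mul_le_mul_of_nonneg_left (min_le_left _ _) hv.le)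
  · exact measurableSet_lt measurable_const
      (measurable_fst.mul (hmin.comp measurable_snd).coe_nnreal_real)

end Pareto

/-! ### The law of the risk-normalized spectral process -/

section RiskLaw

variable {K : Type*} [TopologicalSpace K] [MeasurableSpace (CPlus K)]
  [BorelSpace (CPlus K)] {r : CPlus K → ℝ≥0} {α : ℝ}

lemma measurable_density (hr : IsRiskFunctional r) :
    Measurable fun θ : ℤ → CPlus K => r (θ 0) ^ α :=
  (hr.continuous.measurable.comp (measurable_pi_apply 0)).pow_const α

lemma toReal_lintegral_density (hr : IsRiskFunctional r) (Q : Measure (ℤ → CPlus K)) :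
    (∫⁻ θ, ((r (θ 0) ^ α : ℝ≥0) : ℝ≥0∞) ∂Q).toReal = ∫ θ, (r (θ 0) : ℝ) ^ α ∂Q := by
  rw [integral_eq_lintegral_of_nonneg_ae]
  · congr 1
    refine lintegral_congr fun θ => ?_
    rw [← NNReal.coe_rpow, ENNReal.ofReal_coe_nnreal]
  · exact Eventually.of_forall fun θ => by positivity
  · exact ((hr.continuous.measurable.comp
      (measurable_pi_apply 0)).coe_nnreal_real.pow_const α).aestronglyMeasurable

variable [SecondCountableTopology (CPlus K)]

lemma measurable_normalize (hr : IsRiskFunctional r) :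
    Measurable fun (θ : ℤ → CPlus K) (t : ℤ) => (r (θ 0))⁻¹ • θ t :=
  measurable_pi_lambda _ fun t =>
    (hr.continuous.measurable.comp (measurable_pi_apply 0)).inv.smul (measurable_pi_apply t)

lemma isProbabilityMeasure_riskSpectralLaw (hr : IsRiskFunctional r) {Q : Measure (ℤ → CPlus K)}
    (hpos : 0 < ∫ θ, (r (θ 0) : ℝ) ^ α ∂Q) : IsProbabilityMeasure (riskSpectralLaw r α Q) := by
  -- Positivity of the real number says that the normalizing constant is neither `0` nor `∞`.
  rw [← toReal_lintegral_density hr, ENNReal.toReal_pos_iff] at hpos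
  refine ⟨?_⟩
  rw [riskSpectralLaw, Measure.map_apply (measurable_normalize hr) MeasurableSet.univ,
    Set.preimage_univ, Measure.smul_apply, withDensity_apply _ MeasurableSet.univ,
    Measure.restrict_univ, smul_eq_mul, ENNReal.inv_mul_cancel hpos.1.ne' hpos.2.ne]

/-- The density `r(θ₀)^α` gives no mass to `r(θ₀) = 0`; elsewhere division by `r(θ₀)` normalizes the
risk to `1`. -/
lemma ae_riskSpectralLaw (hr : IsRiskFunctional r) (hα : 0 < α) {Q : Measure (ℤ → CPlus K)} :
    ∀ᵐ θ ∂(riskSpectralLaw r α Q), r (θ 0) = 1 := by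
  have hset : MeasurableSet {θ : ℤ → CPlus K | r (θ 0) = 1} :=
    measurableSet_eq_fun (hr.continuous.measurable.comp (measurable_pi_apply 0)) measurable_const
  rw [riskSpectralLaw, ae_map_iff (measurable_normalize hr).aemeasurable hset]
  refine Measure.ae_smul_measure ?_ _
  rw [ae_withDensity_iff (measurable_density hr).coe_nnreal_ennreal]
  refine Eventually.of_forall fun θ hθ => ?_
  have h0 : r (θ 0) ≠ 0 := by
    intro h
    exact hθ (by rw [h, NNReal.zero_rpow hα.ne', ENNReal.coe_zero])
  rw [hr.homogeneous, inv_mul_cancel₀ h0]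

/-- Expectations of differences of homogeneous functionals under the risk-normalized law. -/
lemma integral_riskSpectralLaw (hr : IsRiskFunctional r) (hα : 0 < α)
    {Q : Measure (ℤ → CPlus K)} {m M : (ℤ → CPlus K) → ℝ≥0} (hm : IsTailFunctional m)
    (hM : IsTailFunctional M) (hle : ∀ x, m x ≤ r (x 0)) :
    ∫ θ, max ((m θ : ℝ) ^ α - (M θ : ℝ) ^ α) 0 ∂(riskSpectralLaw r α Q)
      = (∫ θ, (r (θ 0) : ℝ) ^ α ∂Q)⁻¹ * ∫ θ, max ((m θ : ℝ) ^ α - (M θ : ℝ) ^ α) 0 ∂Q := by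
  have hmeas : Measurable fun θ : ℤ → CPlus K => max ((m θ : ℝ) ^ α - (M θ : ℝ) ^ α) 0 :=
    ((hm.continuous.measurable.coe_nnreal_real.pow_const α).sub
      (hM.continuous.measurable.coe_nnreal_real.pow_const α)).max measurable_const
  rw [riskSpectralLaw, integral_map (measurable_normalize hr).aemeasurable
    hmeas.aestronglyMeasurable, integral_smul_measure, ENNReal.toReal_inv,
    toReal_lintegral_density hr, smul_eq_mul,
    integral_withDensity_eq_integral_smul (measurable_density hr)]
  congr 1
  refine integral_congr_ae (Eventually.of_forall fun θ => ?_)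
  simp only [NNReal.smul_def, smul_eq_mul]
  change ((r (θ 0) ^ α : ℝ≥0) : ℝ) * max ((m ((r (θ 0))⁻¹ • θ) : ℝ) ^ α
    - (M ((r (θ 0))⁻¹ • θ) : ℝ) ^ α) 0 = _
  -- If `r(θ₀) = 0`, the density vanishes on one side and `m θ = 0` on the other. Otherwise the
  -- density cancels the factor `r(θ₀)^(-α)` produced by homogeneity.
  rcases eq_or_ne (r (θ 0)) 0 with h0 | h0
  · have h1 : m θ = 0 := le_antisymm ((hle θ).trans_eq h0) zero_le
    have h2 : 0 ≤ (M θ : ℝ) ^ α := by positivity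
    simp [h0, h1, NNReal.zero_rpow hα.ne', Real.zero_rpow hα.ne', h2]
  · have hpos : (0 : ℝ) < r (θ 0) := by positivity
    have hpow : (0 : ℝ) < (r (θ 0) : ℝ) ^ α := by positivity
    rw [hm.homogeneous, hM.homogeneous, NNReal.coe_mul, NNReal.coe_mul, NNReal.coe_inv,
      Real.mul_rpow (by positivity) (by positivity), Real.mul_rpow (by positivity) (by positivity),
      Real.inv_rpow hpos.le, NNReal.coe_rpow, mul_max_of_nonneg _ _ hpow.le, mul_zero, mul_sub,
      mul_inv_cancel_left₀ hpow.ne', mul_inv_cancel_left₀ hpow.ne']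

end RiskLaw

/-! ### Clusters in terms of minimal and maximal risks -/

section Events

variable {K : Type*} [TopologicalSpace K] {r : CPlus K → ℝ≥0}

lemma lt_minRisk {ℓ : ℕ} (hℓ : 1 ≤ ℓ) {x : ℤ → CPlus K} {w : ℝ≥0} :
    w < minRisk r ℓ x ↔ ∀ i : ℕ, i < ℓ → w < r (x i) := by
  rw [minRisk, Finset.lt_fold_min]
  constructor
  · rintro ⟨h0, h⟩ i hi
    rcases Nat.eq_zero_or_pos i with rfl | hi0
    · exact_mod_cast h0
    · exact h i (Finset.mem_Ico.2 ⟨hi0, hi⟩)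
  · intro h
    exact ⟨by exact_mod_cast h 0 hℓ, fun i hi => h i (Finset.mem_Ico.1 hi).2⟩

/-- The larger one of the risks right before and right after the times `0, …, ℓ - 1`. -/
def boundaryRisk (r : CPlus K → ℝ≥0) (ℓ : ℕ) (x : ℤ → CPlus K) : ℝ≥0 :=
  max (r (x (-1))) (r (x ℓ))

lemma isTailFunctional_boundaryRisk (hr : IsRiskFunctional r) (ℓ : ℕ) :
    IsTailFunctional (boundaryRisk r ℓ) :=
  (IsTailFunctional.eval hr (-1)).max (IsTailFunctional.eval hr ℓ)

lemma lt_mul_minRisk {ℓ : ℕ} (hℓ : 1 ≤ ℓ) {x : ℤ → CPlus K} {u v : ℝ} (hu : 0 ≤ u) :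
    u < v * minRisk r ℓ x ↔ ∀ i : ℕ, i < ℓ → u < v * r (x i) := by
  rcases le_or_gt v 0 with hv | hv
  · have hn : ∀ y : ℝ≥0, ¬ u < v * y := fun y =>
      not_lt.2 ((mul_nonpos_of_nonpos_of_nonneg hv y.2).trans hu)
    exact ⟨fun h => absurd h (hn _), fun h => absurd (h 0 hℓ) (hn _)⟩
  · lift u to ℝ≥0 using hu
    lift v to ℝ≥0 using hv.le
    have hv' : 0 < v := by exact_mod_cast hv
    have key : ∀ y : ℝ≥0, (u : ℝ) < v * y ↔ u / v < y := fun y => by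
      rw [div_lt_iff₀' hv']; exact_mod_cast Iff.rfl
    simp only [key]
    exact lt_minRisk hℓ

/-- The factor `v` serves both cases: `v = 1` for the time series, a Pareto value for the limit.
Since `u ≥ 0`, either side forces `v > 0`. -/
lemma isCluster_mul_iff {ℓ : ℕ} (hℓ : 1 ≤ ℓ) {x : ℤ → CPlus K} {u v : ℝ} (hu : 0 ≤ u) :
    IsCluster (fun t => v * (r (x t) : ℝ)) u 0 ℓ ↔
      u < v * minRisk r ℓ x ∧ v * boundaryRisk r ℓ x ≤ u := by
  rw [lt_mul_minRisk hℓ hu]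
  simp only [IsCluster, zero_add, zero_sub, boundaryRisk, NNReal.coe_max]
  rw [and_left_comm]
  refine and_congr_right fun h => ?_
  have hv : 0 ≤ v := by
    by_contra! hv
    exact absurd (h 0 hℓ) (not_lt.2
      ((mul_nonpos_of_nonpos_of_nonneg hv.le (NNReal.coe_nonneg _)).trans hu))
  rw [mul_max_of_nonneg _ _ hv, max_le_iff]

lemma isCluster_iff {ℓ : ℕ} (hℓ : 1 ≤ ℓ) {x : ℤ → CPlus K} {u : ℝ} (hu : 0 ≤ u) :
    IsCluster (fun t => (r (x t) : ℝ)) u 0 ℓ ↔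
      u < minRisk r ℓ x ∧ boundaryRisk r ℓ x ≤ u := by
  simpa using isCluster_mul_iff (r := r) (v := 1) hℓ hu

variable [MeasurableSpace (CPlus K)] {α : ℝ} {Q : Measure (ℤ → CPlus K)}

/-- The constant `1` in the minimum stands for `r(θ₀)^α`, and the increasing map `x ↦ x ^ α`
commutes with `min` and `max`. -/
lemma limitNumerator_eq (hα : 0 < α) (h1 : ∀ᵐ θ ∂Q, r (θ 0) = 1) (ℓ : ℕ) :
    limitNumerator r α Q ℓ
      = ∫ θ, max ((minRisk r ℓ θ : ℝ) ^ α - (boundaryRisk r ℓ θ : ℝ) ^ α) 0 ∂Q := by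
  refine integral_congr_ae ?_
  filter_upwards [h1] with θ hθ
  have hmono : Monotone fun x : ℝ≥0 => (x : ℝ) ^ α := fun x y hxy =>
    Real.rpow_le_rpow x.2 hxy hα.le
  have h2 := Finset.fold_hom (op := min) (op' := min) (b := r (θ 0)) (s := Finset.Ico 1 ℓ)
    (f := fun i : ℕ => r (θ i)) (m := fun x : ℝ≥0 => (x : ℝ) ^ α) fun x y => hmono.map_min
  have h3 : (boundaryRisk r ℓ θ : ℝ) ^ α = max ((r (θ (-1)) : ℝ) ^ α) ((r (θ ℓ) : ℝ) ^ α) :=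
    hmono.map_max
  rw [hθ, NNReal.coe_one, Real.one_rpow] at h2
  rw [h2, h3, minRisk, hθ]

lemma limitDenominator_eq (h1 : ∀ᵐ θ ∂Q, r (θ 0) = 1) :
    limitDenominator r α Q
      = ∫ θ, max ((r (θ 0) : ℝ) ^ α - (r (θ (-1)) : ℝ) ^ α) 0 ∂Q := by
  refine integral_congr_ae ?_
  filter_upwards [h1] with θ hθ
  rw [hθ, NNReal.coe_one, Real.one_rpow]

end Events

/-! ### Long clusters of a stationary sequence -/

/-- A `u`-exceedance cluster of size larger than `n` starts at time `t`. -/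
def LongClusterStarts (R : ℤ → ℝ) (u : ℝ) (t : ℤ) (n : ℕ) : Prop :=
  R (t - 1) ≤ u ∧ ∀ i : ℕ, i ≤ n → u < R (t + i)

lemma IsStationary.comp {Ω E F : Type*} [MeasurableSpace Ω] [MeasurableSpace E]
    [MeasurableSpace F] {P : Measure Ω} {X : ℤ → Ω → E} (hX : IsStationary P X) {f : E → F}
    (hf : Measurable f) : IsStationary P fun t ω => f (X t ω) where
  measurable t := hf.comp (hX.measurable t)
  map_shift h := by
    have hF : Measurable fun (x : ℤ → E) (t : ℤ) => f (x t) :=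
      measurable_pi_lambda _ fun t => hf.comp (measurable_pi_apply t)
    have h1 := congrArg (Measure.map fun (x : ℤ → E) (t : ℤ) => f (x t)) (hX.map_shift h)
    rwa [Measure.map_map hF (measurable_pi_lambda _ fun t => hX.measurable _),
      Measure.map_map hF (measurable_pi_lambda _ hX.measurable)] at h1

section Stationary

variable {Ω : Type*} [MeasurableSpace Ω] {P : Measure Ω} {R : ℤ → Ω → ℝ}

lemma measurableSet_longClusterStarts (u : ℝ) (t : ℤ) (n : ℕ) :
    MeasurableSet {x : ℤ → ℝ | LongClusterStarts x u t n} := by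
  refine (measurableSet_le (measurable_pi_apply _) measurable_const).inter ?_
  change MeasurableSet {x : ℤ → ℝ | ∀ i : ℕ, i ≤ n → u < x (t + i)}
  simp only [Set.ofPred_forall]
  exact MeasurableSet.iInter fun i => MeasurableSet.iInter fun _ =>
    measurableSet_lt measurable_const (measurable_pi_apply _)

lemma IsStationary.longClusterStarts (hR : IsStationary P R) (u : ℝ) (t : ℤ) (n : ℕ) :
    P.real {ω | LongClusterStarts (fun s => R s ω) u t n}
      = P.real {ω | LongClusterStarts (fun s => R s ω) u 0 n} := by
  have hD := measurableSet_longClusterStarts u 0 n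
  have h := congrArg (fun μ : Measure (ℤ → ℝ) => μ.real {x | LongClusterStarts x u 0 n})
    (hR.map_shift t)
  rw [map_measureReal_apply (measurable_pi_lambda _ fun s => hR.measurable _) hD,
    map_measureReal_apply (measurable_pi_lambda _ hR.measurable) hD] at h
  rw [show {ω | LongClusterStarts (fun s => R s ω) u 0 n}
    = (fun ω s => R s ω) ⁻¹' {x | LongClusterStarts x u 0 n} from rfl, ← h]
  congr 1
  ext ω
  simp only [LongClusterStarts, Set.mem_preimage, Set.mem_ofPred_eq, zero_sub, zero_add]
  rw [neg_add_eq_sub]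
  simp only [add_comm]

variable [IsProbabilityMeasure P]

/-- Long clusters are rare: the clusters that contain time `0` and start at different times are
disjoint. -/
lemma IsStationary.mul_longClusterStarts_le (hR : IsStationary P R) (u : ℝ) (n : ℕ) :
    ((n : ℝ) + 1) * P.real {ω | LongClusterStarts (fun s => R s ω) u 0 n}
      ≤ P.real {ω | u < R 0 ω} := by
  -- A cluster longer than `n` that starts at `-k` with `k ≤ n` contains time `0`.
  let A : ℕ → Set Ω := fun k => {ω | LongClusterStarts (fun s => R s ω) u (-k) n}
  have hA : ∀ k, P.real (A k) = P.real {ω | LongClusterStarts (fun s => R s ω) u 0 n} :=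
    fun k => hR.longClusterStarts u (-k) n
  have hdisj : ∀ k k', k < k' → k' ≤ n → Disjoint (A k) (A k') := by
    intro k k' hk hk'
    refine Set.disjoint_left.2 fun ω h1 h2 => ?_
    -- The cluster started at `-k'` would still be above `u` at time `-k - 1`, where the one
    -- starting at `-k` requires a value at most `u`.
    have h3 := h2.2 (k' - k - 1) (by omega)
    have : (-(k' : ℤ) + ((k' - k - 1 : ℕ) : ℤ)) = -(k : ℤ) - 1 := by omega
    rw [this] at h3
    exact not_lt.2 h1.1 h3
  have hunion : P.real (⋃ k ∈ Finset.range (n + 1), A k)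
      = ∑ k ∈ Finset.range (n + 1), P.real (A k) := by
    refine measureReal_biUnion_finset ?_ fun k _ =>
      (measurable_pi_lambda _ hR.measurable) (measurableSet_longClusterStarts u (-k) n)
    intro k hk k' hk' hne
    simp only [Finset.coe_range, Set.mem_Iio] at hk hk'
    rcases lt_or_gt_of_ne hne with h | h
    · exact hdisj k k' h (by omega)
    · exact (hdisj k' k h (by omega)).symm
  simp only [hA, Finset.sum_const, Finset.card_range, nsmul_eq_mul, Nat.cast_add,
    Nat.cast_one] at hunion
  rw [← hunion]
  refine measureReal_mono (Set.iUnion₂_subset fun k hk ω hω => ?_)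
  have := hω.2 k (by simpa [Nat.lt_succ_iff] using hk)
  simpa using this

/-- The clusters of size at most `n` are those that are not longer. -/
lemma sum_isCluster (hR : ∀ t, Measurable (R t)) (u : ℝ) (n : ℕ) :
    ∑ k ∈ Finset.range n, P.real {ω | IsCluster (fun t => R t ω) u 0 (k + 1)}
      = P.real {ω | ClusterStarts (fun t => R t ω) u 0}
        - P.real {ω | LongClusterStarts (fun s => R s ω) u 0 n} := by
  -- Size exactly `k + 1` means longer than `k` but not longer than `k + 1`, so the sum telescopes.
  have hstep : ∀ k : ℕ, P.real {ω | IsCluster (fun t => R t ω) u 0 (k + 1)}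
      = P.real {ω | LongClusterStarts (fun s => R s ω) u 0 k}
        - P.real {ω | LongClusterStarts (fun s => R s ω) u 0 (k + 1)} := by
    intro k
    rw [← measureReal_sdiff]
    · congr 1
      ext ω
      simp only [IsCluster, LongClusterStarts, Set.mem_ofPred_eq, Set.mem_sdiff, zero_add]
      constructor
      · rintro ⟨h1, h2, h3⟩
        exact ⟨⟨h1, fun i hi => h2 i (by omega)⟩, fun h => not_lt.2 h3 (h.2 (k + 1) le_rfl)⟩
      · rintro ⟨⟨h1, h2⟩, h3⟩
        refine ⟨h1, fun i hi => h2 i (by omega), ?_⟩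
        by_contra! h4
        refine h3 ⟨h1, fun i hi => ?_⟩
        rcases hi.lt_or_eq with hi | rfl
        · exact h2 i (by omega)
        · exact h4
    · exact fun ω h => ⟨h.1, fun i hi => h.2 i (by omega)⟩
    · exact (measurable_pi_lambda _ hR) (measurableSet_longClusterStarts u 0 (k + 1))
  simp_rw [hstep]
  rw [Finset.sum_range_sub']
  congr 2
  ext ω
  simp [LongClusterStarts, ClusterStarts]

end Stationary

/-! ### Monotone transforms -/

section Transform

variable {φ : ℝ → ℝ} {wstar : EReal}

lemma IsMarginalTransform.transformInv_spec (hφ : IsMarginalTransform φ wstar) {u : ℝ}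
    (hu : 0 < u) : transformInv φ wstar u ∈ below wstar ∧ φ (transformInv φ wstar u) = u := by
  obtain ⟨w, hw, hwu⟩ := hφ.bijOn.surjOn hu
  have : ∃ w ∈ below wstar, φ w = u := ⟨w, hw.1, hwu⟩
  exact ⟨Function.invFunOn_mem this, Function.invFunOn_eq this⟩

/-- `φ` may be constant where it is `0`, but it is injective where it is positive; `u > 0` therefore
makes the comparison strict. -/
lemma IsMarginalTransform.transformInv_lt_iff (hφ : IsMarginalTransform φ wstar) {u : ℝ}
    (hu : 0 < u) {w : ℝ} (hw : w ∈ below wstar) : transformInv φ wstar u < w ↔ u < φ w := by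
  obtain ⟨h1, h2⟩ := hφ.transformInv_spec hu
  constructor
  · intro h
    have hle := hφ.monotoneOn h1 hw h.le
    rw [h2] at hle
    refine hle.lt_of_ne fun heq => h.ne ?_
    refine hφ.bijOn.injOn ⟨h1, ?_⟩ ⟨hw, ?_⟩ (h2.trans heq)
    · simpa [h2] using hu
    · simpa [← heq] using hu
  · intro h
    by_contra! hle
    exact absurd (hφ.monotoneOn hw h1 hle) (by rw [h2]; exact not_le.2 h)

/-- The inverse always stays below `w*`, and it is at least any given real `c < w*` as soon as `u >
φ c`. -/
lemma IsMarginalTransform.tendsto_transformInv (hφ : IsMarginalTransform φ wstar) :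
    Tendsto (fun u : ℝ => (transformInv φ wstar u : EReal)) atTop (𝓝 wstar) := by
  rw [tendsto_order]
  constructor
  · intro b hb
    obtain ⟨c, hbc, hcw⟩ := EReal.lt_iff_exists_real_btwn.1 hb
    filter_upwards [eventually_gt_atTop (φ c), eventually_gt_atTop 0] with u hu hu0
    have : c ≤ transformInv φ wstar u := by
      by_contra! h
      exact absurd ((hφ.transformInv_lt_iff hu0 hcw).1 h) (not_lt.2 hu.le)
    exact hbc.trans_le (EReal.coe_le_coe_iff.2 this)
  · intro b hb
    filter_upwards [eventually_gt_atTop 0] with u hu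
    exact (hφ.transformInv_spec hu).1.trans hb

/-- Cluster sizes depend only on which times are exceedances. -/
lemma clusterSizeProb_congr {Ω : Type*} [MeasurableSpace Ω] {P : Measure Ω} {R R' : ℤ → Ω → ℝ}
    {u u' : ℝ} (h : ∀ᵐ ω ∂P, ∀ t, u < R t ω ↔ u' < R' t ω) (ℓ : ℕ) :
    clusterSizeProb P R u ℓ = clusterSizeProb P R' u' ℓ := by
  have h' : ∀ᵐ ω ∂P, ∀ t, R t ω ≤ u ↔ R' t ω ≤ u' := by
    filter_upwards [h] with ω hω t
    rw [← not_lt, ← not_lt, hω t]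
  unfold clusterSizeProb
  congr 1 <;> refine measureReal_congr (eventuallyEq_set.2 ?_)
  · filter_upwards [h, h'] with ω h1 h2
    simp only [IsCluster, h1, h2]
  · filter_upwards [h, h'] with ω h1 h2
    simp only [ClusterStarts, h1, h2]

lemma clusterSizeProb_transform {K : Type*} [TopologicalSpace K] {Ω : Type*} [MeasurableSpace Ω]
    {P : Measure Ω} {X : ℤ → Ω → CPlus K} {W : ℤ → Ω → C(K, ℝ)} {r : CPlus K → ℝ≥0}
    {rho : C(K, ℝ) → ℝ} (hφ : IsMarginalTransform φ wstar)
    (hW : ∀ᵐ ω ∂P, ∀ t s, W t ω s ∈ below wstar ∧ (X t ω s : ℝ) = φ (W t ω s))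
    (hrho : CommutesWith r rho φ wstar) {u : ℝ} (hu : 0 < u) (ℓ : ℕ) :
    clusterSizeProb P (fun t ω => rho (W t ω)) (transformInv φ wstar u) ℓ
      = clusterSizeProb P (fun t ω => (r (X t ω) : ℝ)) u ℓ := by
  refine clusterSizeProb_congr ?_ ℓ
  filter_upwards [hW] with ω hω t
  obtain ⟨h1, h2⟩ := hrho (W t ω) fun s => (hω t s).1
  rw [hφ.transformInv_lt_iff hu h1, h2 (X t ω) fun s => (hω t s).2]

end Transform

/-! ### The limit of the cluster size distribution -/

section Cluster

variable {K : Type*} [TopologicalSpace K] [MeasurableSpace (CPlus K)]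
  [BorelSpace (CPlus K)] [SecondCountableTopology (CPlus K)]
  {Ω Ω' : Type*} [MeasurableSpace Ω] [MeasurableSpace Ω'] {P : Measure Ω} {P' : Measure Ω'}
  {X : ℤ → Ω → CPlus K} {Θ : ℤ → Ω' → CPlus K} {α : ℝ} {r : CPlus K → ℝ≥0}

lemma integral_riskSpectralLaw_map (hα : 0 < α) (hΘ : ∀ t, Measurable (Θ t))
    (hr : IsRiskFunctional r) (hr_pos : 0 < ∫ ω, (r (Θ 0 ω) : ℝ) ^ α ∂P')
    {m M : (ℤ → CPlus K) → ℝ≥0} (hm : IsTailFunctional m)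
    (hM : IsTailFunctional M) (hle : ∀ x, m x ≤ r (x 0)) :
    ∫ ω, max ((m (fun t => Θ t ω) : ℝ) ^ α - (M (fun t => Θ t ω) : ℝ) ^ α) 0 ∂P'
      = (∫ ω, (r (Θ 0 ω) : ℝ) ^ α ∂P') * ∫ θ, max ((m θ : ℝ) ^ α - (M θ : ℝ) ^ α) 0
          ∂(riskSpectralLaw r α (P'.map fun ω t => Θ t ω)) := by
  have hΘm : Measurable fun ω t => Θ t ω := measurable_pi_lambda _ hΘ
  rw [integral_riskSpectralLaw hr hα hm hM hle, integral_map hΘm.aemeasurable,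
    integral_map hΘm.aemeasurable, mul_inv_cancel_left₀ hr_pos.ne']
  · exact (((hm.continuous.measurable.coe_nnreal_real.pow_const α).sub
      (hM.continuous.measurable.coe_nnreal_real.pow_const α)).max
        measurable_const).aestronglyMeasurable
  · exact ((hr.continuous.measurable.comp
      (measurable_pi_apply 0)).coe_nnreal_real.pow_const α).aestronglyMeasurable

/-- The cluster size distribution of the Pareto-scaled spectral process. -/
lemma clusterSizeProb_pareto (hα : 0 < α) (hr : IsRiskFunctional r) {Q : Measure (ℤ → CPlus K)}
    [IsProbabilityMeasure Q] (h1 : ∀ᵐ θ ∂Q, r (θ 0) = 1) {ℓ : ℕ} (hℓ : 1 ≤ ℓ) :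
    clusterSizeProb ((paretoMeasure 1 α).prod Q) (fun t p => p.1 * (r (p.2 t) : ℝ)) 1 ℓ
      = limitNumerator r α Q ℓ / limitDenominator r α Q := by
  have hle : ∀ᵐ θ ∂Q, r (θ 0) ≤ 1 := h1.mono fun θ h => h.le
  have hmeas : ∀ t, Measurable fun θ : ℤ → CPlus K => r (θ t) := fun t =>
    hr.continuous.measurable.comp (measurable_pi_apply t)
  rw [limitNumerator_eq hα h1, limitDenominator_eq h1,
    ← pareto_prod_and hα (isTailFunctional_minRisk hr ℓ).continuous.measurable
      (isTailFunctional_boundaryRisk hr ℓ).continuous.measurable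
      (hle.mono fun θ h => (minRisk_le r ℓ θ).trans h),
    ← pareto_prod_and hα (hmeas 0) (hmeas (-1)) hle, clusterSizeProb]
  congr 2
  · ext p
    exact isCluster_mul_iff hℓ zero_le_one
  · ext p
    simp only [ClusterStarts, Set.mem_ofPred_eq, zero_sub, and_comm]

variable [IsProbabilityMeasure P'] [CompactSpace K] [IsProbabilityMeasure P]

/-- The probability that a cluster of size `ℓ` starts at time `0`, relative to the tail of
`‖X₀‖`. -/
lemma tendsto_isCluster (hα : 0 < α) (hX : IsRegularlyVarying P X α)
    (hΘ : IsSpectralTailProcess P X P' Θ) (hr : IsRiskFunctional r)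
    (hr_pos : 0 < ∫ ω, (r (Θ 0 ω) : ℝ) ^ α ∂P') {ℓ : ℕ} (hℓ : 1 ≤ ℓ) :
    Tendsto (fun u : ℝ => P.real {ω | IsCluster (fun t => (r (X t ω) : ℝ)) u 0 ℓ}
      / normTail P X u) atTop (𝓝 ((∫ ω, (r (Θ 0 ω) : ℝ) ^ α ∂P')
        * limitNumerator r α (riskSpectralLaw r α (P'.map fun ω t => Θ t ω)) ℓ)) := by
  have hm := isTailFunctional_minRisk hr ℓ
  have hM := isTailFunctional_boundaryRisk hr ℓ
  have h := tendsto_tail_functional_and hα hX hΘ hr hm hM (minRisk_le r ℓ)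
  rw [integral_riskSpectralLaw_map hα hΘ.measurable hr hr_pos hm hM (minRisk_le r ℓ),
    ← limitNumerator_eq hα (ae_riskSpectralLaw hr hα)] at h
  refine h.congr' ?_
  filter_upwards [eventually_ge_atTop 0] with u hu
  simp only [isCluster_iff hℓ hu (x := fun t => X t _)]

/-- The probability that a cluster starts at time `0`, relative to the tail of `‖X₀‖`. -/
lemma tendsto_clusterStarts (hα : 0 < α) (hX : IsRegularlyVarying P X α)
    (hΘ : IsSpectralTailProcess P X P' Θ) (hr : IsRiskFunctional r)
    (hr_pos : 0 < ∫ ω, (r (Θ 0 ω) : ℝ) ^ α ∂P') :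
    Tendsto (fun u : ℝ => P.real {ω | ClusterStarts (fun t => (r (X t ω) : ℝ)) u 0}
      / normTail P X u) atTop (𝓝 ((∫ ω, (r (Θ 0 ω) : ℝ) ^ α ∂P')
        * limitDenominator r α (riskSpectralLaw r α (P'.map fun ω t => Θ t ω)))) := by
  have hm := IsTailFunctional.eval hr 0
  have hM := IsTailFunctional.eval hr (-1)
  have h := tendsto_tail_functional_and hα hX hΘ hr hm hM fun _ => le_rfl
  rw [integral_riskSpectralLaw_map hα hΘ.measurable hr hr_pos hm hM fun _ => le_rfl,
    ← limitDenominator_eq (ae_riskSpectralLaw hr hα)] at h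
  refine h.congr fun u => ?_
  simp only [ClusterStarts, zero_sub, and_comm]

/-- `κ` times the remainder of the series after `n` terms is the limit of `P(cluster longer than n
starts at 0) / G(u)`. By `mul_longClusterStarts_le` this is at most `1 / (n + 1)` times the limit
`κ` of `P(r(X₀) > u) / G(u)`, so the remainder is at most `1 / (n + 1)`. -/
lemma hasSum_limitNumerator (hα : 0 < α) (hX : IsRegularlyVarying P X α)
    (hΘ : IsSpectralTailProcess P X P' Θ) (hr : IsRiskFunctional r)
    (hr_pos : 0 < ∫ ω, (r (Θ 0 ω) : ℝ) ^ α ∂P') :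
    HasSum (fun n : ℕ =>
        limitNumerator r α (riskSpectralLaw r α (P'.map fun ω t => Θ t ω)) (n + 1))
      (limitDenominator r α (riskSpectralLaw r α (P'.map fun ω t => Θ t ω))) := by
  set Q := riskSpectralLaw r α (P'.map fun ω t => Θ t ω)
  set κ := ∫ ω, (r (Θ 0 ω) : ℝ) ^ α ∂P'
  have hG := hX.normTail_ratio.1
  have hR : IsStationary P fun t ω => (r (X t ω) : ℝ) :=
    hX.stationary.comp hr.continuous.measurable.coe_nnreal_real
  have hnonneg : ∀ n, 0 ≤ limitNumerator r α Q (n + 1) := fun n =>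
    integral_nonneg fun θ => le_max_right _ _
  rw [hasSum_iff_tendsto_nat_of_nonneg hnonneg]
  have hlim : ∀ n : ℕ, Tendsto (fun u : ℝ =>
      P.real {ω | LongClusterStarts (fun s => (r (X s ω) : ℝ)) u 0 n} / normTail P X u) atTop
      (𝓝 (κ * (limitDenominator r α Q
        - ∑ k ∈ Finset.range n, limitNumerator r α Q (k + 1)))) := by
    intro n
    rw [mul_sub, Finset.mul_sum]
    refine ((tendsto_clusterStarts hα hX hΘ hr hr_pos).sub (tendsto_finsetSum _ fun k _ =>
      tendsto_isCluster hα hX hΘ hr hr_pos (Nat.le_add_left 1 k))).congr fun u => ?_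
    rw [← Finset.sum_div, sum_isCluster hR.measurable, ← sub_div, sub_sub_cancel]
  have hlo : ∀ n : ℕ, 0 ≤ limitDenominator r α Q
      - ∑ k ∈ Finset.range n, limitNumerator r α Q (k + 1) := by
    intro n
    refine nonneg_of_mul_nonneg_right (ge_of_tendsto' (hlim n) fun u => ?_) hr_pos
    exact div_nonneg measureReal_nonneg (hG u).le
  have hup : ∀ n : ℕ, limitDenominator r α Q
      - ∑ k ∈ Finset.range n, limitNumerator r α Q (k + 1) ≤ 1 / ((n : ℝ) + 1) := by
    intro n
    have h0 := tendsto_tail_functional hα hX hΘ hr (IsTailFunctional.eval hr 0) fun _ => le_rfl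
    have h := le_of_tendsto_of_tendsto' ((hlim n).const_mul ((n : ℝ) + 1)) h0 fun u => by
      rw [← mul_div_assoc]
      exact div_le_div_of_nonneg_right (hR.mul_longClusterStarts_le u n) (hG u).le
    rw [le_div_iff₀ (by positivity)]
    refine le_of_mul_le_mul_left ?_ hr_pos
    linarith
  have hdiff : Tendsto (fun n : ℕ => limitDenominator r α Q
      - ∑ k ∈ Finset.range n, limitNumerator r α Q (k + 1)) atTop (𝓝 0) :=
    squeeze_zero hlo hup tendsto_one_div_add_atTop_nhds_zero_nat
  simpa using (tendsto_const_nhds (x := limitDenominator r α Q)).sub hdiff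

end Cluster

end ClusterExtremes

end

open ClusterExtremes in
theorem mainTheorem5 {d : ℕ} (S : Set (EuclideanSpace ℝ (Fin d))) [CompactSpace S]
    [MeasurableSpace (CPlus S)] [BorelSpace (CPlus S)]
    [MeasurableSpace C(S, ℝ)] [BorelSpace C(S, ℝ)]
    {Ω Ω' : Type*} [MeasurableSpace Ω] [MeasurableSpace Ω']
    (P : Measure Ω) [IsProbabilityMeasure P] (P' : Measure Ω') [IsProbabilityMeasure P']
    (α : ℝ) (hα : 0 < α)
    (X : ℤ → Ω → CPlus S) (hX : IsRegularlyVarying P X α)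
    (Θ : ℤ → Ω' → CPlus S) (hΘ : IsSpectralTailProcess P X P' Θ)
    (r : CPlus S → ℝ≥0) (hr : IsRiskFunctional r)
    (hr_pos : 0 < ∫ ω, (r (Θ 0 ω) : ℝ) ^ α ∂P')
    (Q : Measure (ℤ → CPlus S)) (hQ : Q = riskSpectralLaw r α (P'.map (fun ω t => Θ t ω)))
    (hden : 0 < limitDenominator r α Q) :
    -- the cluster size distribution is well defined for all large thresholds
    (∀ᶠ u : ℝ in atTop, 0 < P.real {ω | ClusterStarts (fun t => (r (X t ω) : ℝ)) u 0}) ∧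
    -- the limit of the cluster size probabilities, and its expression through an independent
    -- Pareto variable
    (∀ ℓ : ℕ, 1 ≤ ℓ →
      Tendsto (fun u : ℝ => clusterSizeProb P (fun t ω => (r (X t ω) : ℝ)) u ℓ) atTop
        (𝓝 (limitNumerator r α Q ℓ / limitDenominator r α Q)) ∧
      clusterSizeProb ((paretoMeasure 1 α).prod Q) (fun t p => p.1 * (r (p.2 t) : ℝ)) 1 ℓ
        = limitNumerator r α Q ℓ / limitDenominator r α Q) ∧
    -- the limits form a probability distribution on the positive integers
    HasSum (fun n : ℕ => limitNumerator r α Q (n + 1) / limitDenominator r α Q) 1 ∧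
    -- monotone transforms
    (∀ (wstar : EReal) (φ : ℝ → ℝ), IsMarginalTransform φ wstar →
      ∀ W : ℤ → Ω → C(S, ℝ), IsStationary P W →
      (∀ᵐ ω ∂P, ∀ t s, W t ω s ∈ below wstar ∧ (X t ω s : ℝ) = φ (W t ω s)) →
      ∀ rho : C(S, ℝ) → ℝ, CommutesWith r rho φ wstar →
        Tendsto (fun u : ℝ => (transformInv φ wstar u : EReal)) atTop (𝓝 wstar) ∧
        ∀ ℓ : ℕ, 1 ≤ ℓ →
          (∀ u : ℝ, 0 < u →
            clusterSizeProb P (fun t ω => rho (W t ω)) (transformInv φ wstar u) ℓ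
              = clusterSizeProb P (fun t ω => (r (X t ω) : ℝ)) u ℓ) ∧
          Tendsto (fun u : ℝ =>
              clusterSizeProb P (fun t ω => rho (W t ω)) (transformInv φ wstar u) ℓ) atTop
            (𝓝 (limitNumerator r α Q ℓ / limitDenominator r α Q))) := by
  have hΘm : Measurable fun ω t => Θ t ω := measurable_pi_lambda _ hΘ.measurable
  have hprob : IsProbabilityMeasure Q := by
    rw [hQ]
    refine isProbabilityMeasure_riskSpectralLaw hr ?_
    have hm : Measurable fun θ : ℤ → CPlus S => (r (θ 0) : ℝ) ^ α :=
      ((hr.continuous.measurable.comp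
      (measurable_pi_apply 0)).coe_nnreal_real.pow_const α)
    rwa [integral_map hΘm.aemeasurable hm.aestronglyMeasurable]
  have hone : ∀ᵐ θ ∂Q, r (θ 0) = 1 := by rw [hQ]; exact ae_riskSpectralLaw hr hα
  have hG := hX.normTail_ratio.1
  have hstart := tendsto_clusterStarts hα hX hΘ hr hr_pos
  rw [← hQ] at hstart
  have hlim : ∀ ℓ : ℕ, 1 ≤ ℓ →
      Tendsto (fun u : ℝ => clusterSizeProb P (fun t ω => (r (X t ω) : ℝ)) u ℓ) atTop
        (𝓝 (limitNumerator r α Q ℓ / limitDenominator r α Q)) := by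
    intro ℓ hℓ
    have hnum := tendsto_isCluster hα hX hΘ hr hr_pos hℓ
    rw [← hQ] at hnum
    -- Both limits are relative to `G(u)` and carry the factor `E[r(Θ₀)^α]`; both cancel in the
    -- quotient.
    have h := hnum.div hstart (mul_pos hr_pos hden).ne'
    rw [mul_div_mul_left _ _ hr_pos.ne'] at h
    exact h.congr fun u => div_div_div_cancel_right₀ (hG u).ne' _ _
  refine ⟨?_, fun ℓ hℓ => ⟨hlim ℓ hℓ, clusterSizeProb_pareto hα hr hone hℓ⟩, ?_, ?_⟩
  · filter_upwards [hstart.eventually (lt_mem_nhds (mul_pos hr_pos hden))] with u hu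
    exact (div_pos_iff_of_pos_right (hG u)).1 hu
  · have h := hasSum_limitNumerator hα hX hΘ hr hr_pos
    rw [← hQ] at h
    simpa [hden.ne'] using h.div_const (limitDenominator r α Q)
  · intro wstar φ hφ W _ hWX rho hrho
    refine ⟨hφ.tendsto_transformInv, fun ℓ hℓ => ⟨fun u hu =>
      clusterSizeProb_transform hφ hWX hrho hu ℓ, (hlim ℓ hℓ).congr' ?_⟩⟩
    filter_upwards [eventually_gt_atTop 0] with u hu
    exact (clusterSizeProb_transform hφ hWX hrho hu ℓ).symm
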